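/- All theories below are theories in intuitionistic first-order predicate logic (natural deduction with $\top,\bot,\wedge,\vee,\Rightarrow,\forall,\exists$; $\neg A$ is $A\Rightarrow\bot$; equality is an ordinary predicate symbol). Open axioms and instances of schemes stand for their universal closures; propositions $P$ in induction schemes may have further free variables (parameters). $\mathrm{HA}_{Pred}$ has the symbols $0,S,+,\times,Pred,=$. Its axioms are the axioms of equality for these symbols ($=$ is an equivalence relation compatible with $S,+,\times,Pred$), the propositions $$\forall x\forall y\,(S(x)=S(y)\Rightarrow x=y),\quad \forall x\,\neg(0=S(x)),\quad Pred(0)=0,\quad \forall x\,(Pred(S(x))=x),$$ $$\forall y\,(0+y=y),\quad \forall x\forall y\,(S(x)+y=S(x+y)),\quad \forall y\,(0\times y=0),\quad \forall x\forall y\,(S(x)\times y=x\times y+y),$$ and the induction scheme $$(0/x)P\Rightarrow\forall y\,((y/x)P\Rightarrow(S(y)/x)P)\Rightarrow\forall n\,(n/x)P$$ for every proposition $P$ of the language $0,S,+,\times,=$ of Heyting arithmetic. $\mathrm{HA}_N$ has the symbols $0,S,+,\times,Pred,=$ and the unary predicates $Null$ and $N$. Its axioms are the axioms of equality for all these symbols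 (including compatibility of $=$ with $Null$ and $N$), the above axioms for $Pred$, $+$ and $\times$, the propositions $$N(0),\quad \forall x\,(N(x)\Rightarrow N(S(x))),\quad Null(0),\quad \forall x\,\neg Null(S(x)),$$ and the induction scheme $$(0/x)P\Rightarrow\forall y\,(N(y)\Rightarrow(y/x)P\Rightarrow(S(y)/x)P)\Rightarrow\forall n\,(N(n)\Rightarrow(n/x)P)$$ for every proposition $P$ of the language of $\mathrm{HA}_N$. The relativization $|A|$ of a proposition $A$ of the language of $\mathrm{HA}_{Pred}$ is defined by $|A|=A$ for $A$ atomic, $\top$ or $\bot$; $|\cdot|$ commutes with $\wedge,\vee,\Rightarrow$; $|\forall x\,A|=\forall x\,(N(x)\Rightarrow|A|)$ and $|\exists x\,A|=\exists x\,(N(x)\wedge|A|)$. **Theorem.** Let $A$ be a closed proposition in the language of $\mathrm{HA}_{Pred}$. Then $A$ is provable in $\mathrm{HA}_{Pred}$ if and only if $|A|$ is provable in $\mathrm{HA}_N$. The same equivalence holds for the variant of $\mathrm{HA}_{Pred}$ in which the symbol $Pred$ may also occur in the propositions $P$ of the induction scheme. -/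

import Mathlib

namespace HeytingArith

open FirstOrder

/-! ### First-order intuitionistic predicate logic

The terms are those of Mathlib's `FirstOrder.Language`. Mathlib's formulas are built from `⊥`, `⇒`
and `∀` only, which is not enough for intuitionistic logic, so the propositions are defined here.
Equality is not a logical symbol: it is an ordinary predicate symbol governed by axioms. -/

/-- Propositions over `L` whose free variables are among the `n` variables indexed by `Fin n`.
A quantifier binds the variable `0` of its body; the variable `i` of the whole proposition is
the variable `i + 1` inside the body. -/
inductive Fml (L : FirstOrder.Language.{0, 0}) : ℕ → Type
  | rel {n k : ℕ} (R : L.Relations k) (ts : Fin k → L.Term (Fin n)) : Fml L n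
  | top {n : ℕ} : Fml L n
  | bot {n : ℕ} : Fml L n
  | and {n : ℕ} (A B : Fml L n) : Fml L n
  | or {n : ℕ} (A B : Fml L n) : Fml L n
  | imp {n : ℕ} (A B : Fml L n) : Fml L n
  | all {n : ℕ} (A : Fml L (n + 1)) : Fml L n
  | ex {n : ℕ} (A : Fml L (n + 1)) : Fml L n

/-- Closed propositions. -/
abbrev Sentence (L : FirstOrder.Language.{0, 0}) : Type := Fml L 0

namespace Fml

variable {L L' : FirstOrder.Language.{0, 0}}

/-- Negation: `¬ A` is `A ⇒ ⊥`. -/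
def neg {n : ℕ} (A : Fml L n) : Fml L n := A.imp bot

/-- The substitution `σ` carried under a binder. -/
def liftSubst {n m : ℕ} (σ : Fin n → L.Term (Fin m)) : Fin (n + 1) → L.Term (Fin (m + 1)) :=
  Fin.cases (FirstOrder.Language.Term.var 0) (fun i => (σ i).relabel Fin.succ)

/-- Simultaneous capture-avoiding substitution of terms for the free variables. -/
def subst : {n : ℕ} → Fml L n → {m : ℕ} → (Fin n → L.Term (Fin m)) → Fml L m
  | _, rel R ts, _, σ => rel R (fun i => (ts i).subst σ)
  | _, top, _, _ => top
  | _, bot, _, _ => bot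
  | _, and A B, _, σ => and (A.subst σ) (B.subst σ)
  | _, or A B, _, σ => or (A.subst σ) (B.subst σ)
  | _, imp A B, _, σ => imp (A.subst σ) (B.subst σ)
  | _, all A, _, σ => all (A.subst (liftSubst σ))
  | _, ex A, _, σ => ex (A.subst (liftSubst σ))

/-- `A` regarded as a proposition with one more (fresh) variable, the variable `0`. -/
def shift {n : ℕ} (A : Fml L n) : Fml L (n + 1) :=
  A.subst (fun i => FirstOrder.Language.Term.var i.succ)

/-- `(t/x)A`, where `x` is the variable `0` of `A`. -/
def inst {n : ℕ} (A : Fml L (n + 1)) (t : L.Term (Fin n)) : Fml L n :=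
  A.subst (Fin.cases t FirstOrder.Language.Term.var)

/-- Universal closure. -/
def close : {n : ℕ} → Fml L n → Sentence L
  | 0, A => A
  | _ + 1, A => close (all A)

/-- A proposition read in a larger language. -/
def map (φ : L →ᴸ L') : {n : ℕ} → Fml L n → Fml L' n
  | _, rel R ts => rel (φ.onRelation R) (fun i => φ.onTerm (ts i))
  | _, top => top
  | _, bot => bot
  | _, and A B => and (A.map φ) (B.map φ)
  | _, or A B => or (A.map φ) (B.map φ)
  | _, imp A B => imp (A.map φ) (B.map φ)
  | _, all A => all (A.map φ)
  | _, ex A => ex (A.map φ)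

end Fml

/-- Intuitionistic natural deduction: `Deriv Γ A` says that the sequent `Γ ⊢ A` is derivable.
The set `Γ` may be infinite. In the rules `allI` and `exE` the fresh variable is the variable `0`,
which occurs neither in the shifted hypotheses nor in the shifted conclusion. -/
inductive Deriv {L : FirstOrder.Language.{0, 0}} : {n : ℕ} → Set (Fml L n) → Fml L n → Prop
  | ax {n : ℕ} {Γ : Set (Fml L n)} {A : Fml L n} : A ∈ Γ → Deriv Γ A
  | impI {n : ℕ} {Γ : Set (Fml L n)} {A B : Fml L n} :
      Deriv (insert A Γ) B → Deriv Γ (A.imp B)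
  | impE {n : ℕ} {Γ : Set (Fml L n)} {A B : Fml L n} :
      Deriv Γ (A.imp B) → Deriv Γ A → Deriv Γ B
  | andI {n : ℕ} {Γ : Set (Fml L n)} {A B : Fml L n} :
      Deriv Γ A → Deriv Γ B → Deriv Γ (A.and B)
  | andE₁ {n : ℕ} {Γ : Set (Fml L n)} {A B : Fml L n} : Deriv Γ (A.and B) → Deriv Γ A
  | andE₂ {n : ℕ} {Γ : Set (Fml L n)} {A B : Fml L n} : Deriv Γ (A.and B) → Deriv Γ B
  | orI₁ {n : ℕ} {Γ : Set (Fml L n)} {A B : Fml L n} : Deriv Γ A → Deriv Γ (A.or B)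
  | orI₂ {n : ℕ} {Γ : Set (Fml L n)} {A B : Fml L n} : Deriv Γ B → Deriv Γ (A.or B)
  | orE {n : ℕ} {Γ : Set (Fml L n)} {A B C : Fml L n} :
      Deriv Γ (A.or B) → Deriv (insert A Γ) C → Deriv (insert B Γ) C → Deriv Γ C
  | topI {n : ℕ} {Γ : Set (Fml L n)} : Deriv Γ Fml.top
  | botE {n : ℕ} {Γ : Set (Fml L n)} {A : Fml L n} : Deriv Γ Fml.bot → Deriv Γ A
  | allI {n : ℕ} {Γ : Set (Fml L n)} {A : Fml L (n + 1)} :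
      Deriv (Fml.shift '' Γ) A → Deriv Γ A.all
  | allE {n : ℕ} {Γ : Set (Fml L n)} {A : Fml L (n + 1)} (t : L.Term (Fin n)) :
      Deriv Γ A.all → Deriv Γ (A.inst t)
  | exI {n : ℕ} {Γ : Set (Fml L n)} {A : Fml L (n + 1)} (t : L.Term (Fin n)) :
      Deriv Γ (A.inst t) → Deriv Γ A.ex
  | exE {n : ℕ} {Γ : Set (Fml L n)} {A : Fml L (n + 1)} {B : Fml L n} :
      Deriv Γ A.ex → Deriv (insert A (Fml.shift '' Γ)) B.shift → Deriv Γ B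

/-- The sentence `A` is (intuitionistically) provable in the theory with set of axioms `T`. -/
def Provable {L : FirstOrder.Language.{0, 0}} (T : Set (Sentence L)) (A : Sentence L) : Prop :=
  Deriv T A

/-! ### The three languages -/

/-- The function symbols `0`, `S`, `+`, `×`. -/
inductive HAFunc : ℕ → Type
  | zero : HAFunc 0
  | succ : HAFunc 1
  | add : HAFunc 2
  | mul : HAFunc 2

/-- The function symbols `0`, `S`, `+`, `×`, `Pred`. -/
inductive PredFunc : ℕ → Type
  | zero : PredFunc 0
  | succ : PredFunc 1
  | add : PredFunc 2
  | mul : PredFunc 2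
  | pred : PredFunc 1

/-- The predicate symbol `=`. -/
inductive EqRel : ℕ → Type
  | eq : EqRel 2

/-- The predicate symbols `=`, `Null`, `N`. -/
inductive NRel : ℕ → Type
  | eq : NRel 2
  | null : NRel 1
  | nat : NRel 1

/-- The language of HA: `0`, `S`, `+`, `×`, `=`. -/
def LHA : FirstOrder.Language.{0, 0} := ⟨HAFunc, EqRel⟩

/-- The language of HA_Pred: `0`, `S`, `+`, `×`, `Pred`, `=`. -/
def LPred : FirstOrder.Language.{0, 0} := ⟨PredFunc, EqRel⟩

/-- The language of HA_N: `0`, `S`, `+`, `×`, `Pred`, `=`, `Null`, `N`. -/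
def LN : FirstOrder.Language.{0, 0} := ⟨PredFunc, NRel⟩

/-- The inclusion of the language of HA in the language of HA_Pred. -/
def inclPred : LHA →ᴸ LPred where
  onFunction := fun
    | _, HAFunc.zero => PredFunc.zero
    | _, HAFunc.succ => PredFunc.succ
    | _, HAFunc.add => PredFunc.add
    | _, HAFunc.mul => PredFunc.mul
  onRelation := fun _ R => R

/-- The inclusion of the language of HA_Pred in the language of HA_N. -/
def inclN : LPred →ᴸ LN where
  onFunction := fun _ f => f
  onRelation := fun
    | _, EqRel.eq => NRel.eq

/-- The symbols `0`, `S`, `+`, `×`, `Pred`, `=` of a language, so that the axioms common to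
HA_Pred and HA_N can be written once. -/
class ArithSymbols (L : FirstOrder.Language.{0, 0}) where
  zero : L.Functions 0
  succ : L.Functions 1
  add : L.Functions 2
  mul : L.Functions 2
  pred : L.Functions 1
  eq : L.Relations 2

instance : ArithSymbols LPred where
  zero := PredFunc.zero
  succ := PredFunc.succ
  add := PredFunc.add
  mul := PredFunc.mul
  pred := PredFunc.pred
  eq := EqRel.eq

instance : ArithSymbols LN where
  zero := PredFunc.zero
  succ := PredFunc.succ
  add := PredFunc.add
  mul := PredFunc.mul
  pred := PredFunc.pred
  eq := NRel.eq

section Axioms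

variable {L : FirstOrder.Language.{0, 0}} [ArithSymbols L] {n : ℕ}

/-- The term `0`. -/
def zeroT : L.Term (Fin n) := FirstOrder.Language.Term.func (ArithSymbols.zero (L := L)) ![]

/-- The term `S(t)`. -/
def succT (t : L.Term (Fin n)) : L.Term (Fin n) :=
  FirstOrder.Language.Term.func (ArithSymbols.succ (L := L)) ![t]

/-- The term `t + u`. -/
def addT (t u : L.Term (Fin n)) : L.Term (Fin n) :=
  FirstOrder.Language.Term.func (ArithSymbols.add (L := L)) ![t, u]

/-- The term `t × u`. -/
def mulT (t u : L.Term (Fin n)) : L.Term (Fin n) :=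
  FirstOrder.Language.Term.func (ArithSymbols.mul (L := L)) ![t, u]

/-- The term `Pred(t)`. -/
def predT (t : L.Term (Fin n)) : L.Term (Fin n) :=
  FirstOrder.Language.Term.func (ArithSymbols.pred (L := L)) ![t]

/-- The proposition `t = u`. -/
def eqF (t u : L.Term (Fin n)) : Fml L n := Fml.rel (ArithSymbols.eq (L := L)) ![t, u]

/-- The variable number `i`. -/
def v (i : Fin n) : L.Term (Fin n) := FirstOrder.Language.Term.var i

variable (L)

/-- The axioms of equality for `=`, `S`, `+`, `×` and `Pred`: `=` is an equivalence relation
compatible with the function symbols. -/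
inductive EqAxiom : Sentence L → Prop
  /-- `∀x (x = x)` -/
  | refl : EqAxiom (Fml.all (eqF (v 0) (v 0)))
  /-- `∀x ∀y (x = y ⇒ y = x)` -/
  | symm : EqAxiom (Fml.all (Fml.all ((eqF (v 1) (v 0)).imp (eqF (v 0) (v 1)))))
  /-- `∀x ∀y ∀z (x = y ⇒ y = z ⇒ x = z)` -/
  | trans : EqAxiom (Fml.all (Fml.all (Fml.all
      ((eqF (v 2) (v 1)).imp ((eqF (v 1) (v 0)).imp (eqF (v 2) (v 0)))))))
  /-- `∀x ∀y (x = y ⇒ S(x) = S(y))` -/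
  | succ : EqAxiom (Fml.all (Fml.all
      ((eqF (v 1) (v 0)).imp (eqF (succT (v 1)) (succT (v 0))))))
  /-- `∀x ∀x' ∀y ∀y' (x = x' ⇒ y = y' ⇒ x + y = x' + y')` -/
  | add : EqAxiom (Fml.all (Fml.all (Fml.all (Fml.all
      ((eqF (v 3) (v 2)).imp ((eqF (v 1) (v 0)).imp
        (eqF (addT (v 3) (v 1)) (addT (v 2) (v 0)))))))))
  /-- `∀x ∀x' ∀y ∀y' (x = x' ⇒ y = y' ⇒ x × y = x' × y')` -/
  | mul : EqAxiom (Fml.all (Fml.all (Fml.all (Fml.all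
      ((eqF (v 3) (v 2)).imp ((eqF (v 1) (v 0)).imp
        (eqF (mulT (v 3) (v 1)) (mulT (v 2) (v 0)))))))))
  /-- `∀x ∀y (x = y ⇒ Pred(x) = Pred(y))` -/
  | pred : EqAxiom (Fml.all (Fml.all
      ((eqF (v 1) (v 0)).imp (eqF (predT (v 1)) (predT (v 0))))))

/-- The defining axioms of `Pred`, `+` and `×`. -/
inductive DefAxiom : Sentence L → Prop
  /-- `Pred(0) = 0` -/
  | predZero : DefAxiom (eqF (predT zeroT) zeroT)
  /-- `∀x (Pred(S(x)) = x)` -/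
  | predSucc : DefAxiom (Fml.all (eqF (predT (succT (v 0))) (v 0)))
  /-- `∀y (0 + y = y)` -/
  | zeroAdd : DefAxiom (Fml.all (eqF (addT zeroT (v 0)) (v 0)))
  /-- `∀x ∀y (S(x) + y = S(x + y))` -/
  | succAdd : DefAxiom (Fml.all (Fml.all
      (eqF (addT (succT (v 1)) (v 0)) (succT (addT (v 1) (v 0))))))
  /-- `∀y (0 × y = 0)` -/
  | zeroMul : DefAxiom (Fml.all (eqF (mulT zeroT (v 0)) zeroT))
  /-- `∀x ∀y (S(x) × y = x × y + y)` -/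
  | succMul : DefAxiom (Fml.all (Fml.all
      (eqF (mulT (succT (v 1)) (v 0)) (addT (mulT (v 1) (v 0)) (v 0)))))

variable {L}

/-- `(S(x)/x)P`, where `x` is the variable `0` of `P`. -/
def atSucc (P : Fml L (n + 1)) : Fml L (n + 1) :=
  P.subst (Fin.cases (succT (v 0)) (fun i => v i.succ))

/-- The induction proposition
`(0/x)P ⇒ ∀y ((y/x)P ⇒ (S(y)/x)P) ⇒ ∀n (n/x)P`, where `x` is the variable `0` of `P`. -/
def indF (P : Fml L (n + 1)) : Fml L n :=
  (P.inst zeroT).imp ((Fml.all (P.imp (atSucc P))).imp (Fml.all P))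

end Axioms

/-! ### The theory HA_Pred -/

/-- The axioms of HA_Pred other than induction. -/
inductive HAPredBase : Sentence LPred → Prop
  | eqAx {A : Sentence LPred} : EqAxiom LPred A → HAPredBase A
  | defAx {A : Sentence LPred} : DefAxiom LPred A → HAPredBase A
  /-- `∀x ∀y (S(x) = S(y) ⇒ x = y)` -/
  | succInj : HAPredBase (Fml.all (Fml.all
      ((eqF (succT (v 1)) (succT (v 0))).imp (eqF (v 1) (v 0)))))
  /-- `∀x ¬ (0 = S(x))` -/
  | zeroNeSucc : HAPredBase (Fml.all (eqF zeroT (succT (v 0))).neg)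

/-- The axioms of HA_Pred: the extension of HA with the symbol `Pred` and its axioms. The induction
scheme is the one of HA: the induction propositions are those of the language of HA, with
parameters, and each instance is universally closed. -/
def HAPred : Set (Sentence LPred) :=
  {A | HAPredBase A ∨ ∃ (n : ℕ) (P : Fml LHA (n + 1)), A = (indF (P.map inclPred)).close}

/-- The variant of HA_Pred in which `Pred` may occur in the induction propositions. -/
def HAPredFull : Set (Sentence LPred) :=
  {A | HAPredBase A ∨ ∃ (n : ℕ) (P : Fml LPred (n + 1)), A = (indF P).close}

/-! ### The theory HA_N -/

/-- The proposition `N(t)`. -/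
def natF {n : ℕ} (t : LN.Term (Fin n)) : Fml LN n := Fml.rel (L := LN) NRel.nat ![t]

/-- The proposition `Null(t)`. -/
def nullF {n : ℕ} (t : LN.Term (Fin n)) : Fml LN n := Fml.rel (L := LN) NRel.null ![t]

/-- The induction proposition of HA_N,
`(0/x)P ⇒ ∀y (N(y) ⇒ (y/x)P ⇒ (S(y)/x)P) ⇒ ∀n (N(n) ⇒ (n/x)P)`, where `x` is the
variable `0` of `P`. -/
def indNF {n : ℕ} (P : Fml LN (n + 1)) : Fml LN n :=
  (P.inst zeroT).imp
    ((Fml.all ((natF (v 0)).imp (P.imp (atSucc P)))).imp (Fml.all ((natF (v 0)).imp P)))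

/-- The axioms of HA_N. All the symbols may occur in the induction propositions, and each instance
of induction is universally closed. -/
inductive HANAxiom : Sentence LN → Prop
  | eqAx {A : Sentence LN} : EqAxiom LN A → HANAxiom A
  /-- `∀x ∀y (x = y ⇒ Null(x) ⇒ Null(y))` -/
  | eqNull : HANAxiom (Fml.all (Fml.all
      ((eqF (v 1) (v 0)).imp ((nullF (v 1)).imp (nullF (v 0))))))
  /-- `∀x ∀y (x = y ⇒ N(x) ⇒ N(y))` -/
  | eqNat : HANAxiom (Fml.all (Fml.all
      ((eqF (v 1) (v 0)).imp ((natF (v 1)).imp (natF (v 0))))))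
  | defAx {A : Sentence LN} : DefAxiom LN A → HANAxiom A
  /-- `N(0)` -/
  | natZero : HANAxiom (natF zeroT)
  /-- `∀x (N(x) ⇒ N(S(x)))` -/
  | natSucc : HANAxiom (Fml.all ((natF (v 0)).imp (natF (succT (v 0)))))
  /-- `Null(0)` -/
  | nullZero : HANAxiom (nullF zeroT)
  /-- `∀x ¬ Null(S(x))` -/
  | nullSucc : HANAxiom (Fml.all (nullF (succT (v 0))).neg)
  | ind {n : ℕ} (P : Fml LN (n + 1)) : HANAxiom (indNF P).close

/-- The set of axioms of HA_N. -/
def HAN : Set (Sentence LN) := {A | HANAxiom A}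

/-! ### The translation -/

/-- The relativization `|A|` of a proposition of the language of HA_Pred to `N`. -/
def relativize : {n : ℕ} → Fml LPred n → Fml LN n
  | _, Fml.rel R ts => (Fml.rel R ts).map inclN
  | _, Fml.top => Fml.top
  | _, Fml.bot => Fml.bot
  | _, Fml.and A B => (relativize A).and (relativize B)
  | _, Fml.or A B => (relativize A).or (relativize B)
  | _, Fml.imp A B => (relativize A).imp (relativize B)
  | _, Fml.all A => Fml.all ((natF (v 0)).imp (relativize A))
  | _, Fml.ex A => Fml.ex ((natF (v 0)).and (relativize A))

end HeytingArith

namespace HeytingArith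

open FirstOrder FirstOrder.Language

variable {L L' : FirstOrder.Language.{0, 0}}

/-! ### Substitution -/

/-! The two versions of HA_Pred have the same theorems, and the full version and HA_N are linked by
a pair of translations whose composite is the identity up to provable equivalence.

From HA_Pred to HA_N, relativization preserves derivability (`Deriv.relativize`). Instantiating a
relativized quantifier at a term requires `N` of that term, and `Extends.nat_term` supplies it: `N`
is closed under `Pred`, `+` and `×` by induction in HA_N. The relativized axioms are provable.
Induction becomes literally an induction axiom of HA_N, injectivity of `S` comes from `Pred`, and `0
≠ S(x)` comes from `Null`.

Back from HA_N to HA_Pred, `interp` reads `N(t)` as `⊤` and `Null(t)` as `t = 0`. Every axiom of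
HA_N becomes a theorem (`provable_interp_axiom`), and `interp (relativize A)` differs from `A` only
by trivial premises and conjuncts `⊤` (`interp_relativize`).

Both arguments use induction on propositions containing `Pred`. The restricted scheme suffices
because `Pred` is eliminable (`PredElim.of_fml`): nested terms are unfolded by `P(t) ⇔ ∃x (x = t ∧
P(x))`, and `x = Pred(y)` is replaced by `(y = 0 ∧ x = 0) ∨ y = S(x)`. This graph is justified by
the fact that every number is `0` or a successor, itself proved by an induction without `Pred`. -/

theorem term_subst_subst {α β γ : Type} (t : L.Term α) (σ : α → L.Term β) (τ : β → L.Term γ) :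
    (t.subst σ).subst τ = t.subst (fun i => (σ i).subst τ) := by
  induction t with
  | var i => rfl
  | func f ts ih => simp only [Term.subst, ih]

theorem term_subst_var {α : Type} (t : L.Term α) : t.subst Term.var = t := by
  induction t with
  | var i => rfl
  | func f ts ih => simp only [Term.subst, ih]

theorem term_relabel_eq {α β : Type} (t : L.Term α) (g : α → β) :
    t.relabel g = t.subst (fun i => Term.var (g i)) := by
  induction t with
  | var i => rfl
  | func f ts ih => simp only [Term.subst, Term.relabel, ih]

theorem onTerm_subst {α β : Type} (φ : L →ᴸ L') (t : L.Term α) (σ : α → L.Term β) :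
    φ.onTerm (t.subst σ) = (φ.onTerm t).subst (fun i => φ.onTerm (σ i)) := by
  induction t with
  | var i => rfl
  | func f ts ih => simp only [Term.subst, LHom.onTerm, ih]

namespace Fml

/-- The substitution of `t` for the variable `0` and of `σ` for the others. -/
def consSubst {n m : ℕ} (t : L.Term (Fin m)) (σ : Fin n → L.Term (Fin m)) :
    Fin (n + 1) → L.Term (Fin m) := Fin.cases t σ

@[simp] theorem consSubst_zero {n m : ℕ} (t : L.Term (Fin m)) (σ : Fin n → L.Term (Fin m)) :
    consSubst t σ 0 = t := rfl

@[simp] theorem consSubst_succ {n m : ℕ} (t : L.Term (Fin m)) (σ : Fin n → L.Term (Fin m))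
    (i : Fin n) : consSubst t σ i.succ = σ i := rfl

@[simp] theorem liftSubst_zero {n m : ℕ} (σ : Fin n → L.Term (Fin m)) :
    liftSubst σ 0 = Term.var 0 := rfl

-- Renaming becomes substitution here, so that `term_subst_subst` alone normalizes compositions
-- under binders.
@[simp] theorem liftSubst_succ {n m : ℕ} (σ : Fin n → L.Term (Fin m)) (i : Fin n) :
    liftSubst σ i.succ = (σ i).subst (fun j => Term.var j.succ) := term_relabel_eq _ _

theorem liftSubst_var {n : ℕ} : liftSubst (L := L) (Term.var : Fin n → _) = Term.var := by
  funext i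
  refine Fin.cases rfl (fun i => ?_) i
  simp [Term.subst]

theorem liftSubst_comp {n m k : ℕ} (σ : Fin n → L.Term (Fin m)) (τ : Fin m → L.Term (Fin k)) :
    (fun i => (liftSubst σ i).subst (liftSubst τ)) = liftSubst (fun i => (σ i).subst τ) := by
  funext i
  refine Fin.cases rfl (fun i => ?_) i
  simp [term_subst_subst, Term.subst]

theorem subst_subst {n : ℕ} (A : Fml L n) {m k : ℕ} (σ : Fin n → L.Term (Fin m))
    (τ : Fin m → L.Term (Fin k)) :
    (A.subst σ).subst τ = A.subst (fun i => (σ i).subst τ) := by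
  induction A generalizing m k with
  | rel R ts => simp only [subst, term_subst_subst]
  | top => rfl
  | bot => rfl
  | and A B hA hB => simp only [subst, hA, hB]
  | or A B hA hB => simp only [subst, hA, hB]
  | imp A B hA hB => simp only [subst, hA, hB]
  | all A hA => simp only [subst, hA, liftSubst_comp]
  | ex A hA => simp only [subst, hA, liftSubst_comp]

@[simp] theorem subst_var {n : ℕ} (A : Fml L n) : A.subst Term.var = A := by
  induction A with
  | rel R ts => simp only [subst, term_subst_var]
  | top => rfl
  | bot => rfl
  | and A B hA hB => simp only [subst, hA, hB]
  | or A B hA hB => simp only [subst, hA, hB]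
  | imp A B hA hB => simp only [subst, hA, hB]
  | all A hA => simp only [subst, hA, liftSubst_var]
  | ex A hA => simp only [subst, hA, liftSubst_var]

theorem inst_eq {n : ℕ} (A : Fml L (n + 1)) (t : L.Term (Fin n)) :
    A.inst t = A.subst (consSubst t Term.var) := rfl

theorem shift_eq {n : ℕ} (A : Fml L n) :
    A.shift = A.subst (fun i => Term.var i.succ) := rfl

theorem shift_subst_liftSubst {n m : ℕ} (A : Fml L n) (σ : Fin n → L.Term (Fin m)) :
    A.shift.subst (liftSubst σ) = (A.subst σ).shift := by
  simp only [shift_eq, subst_subst, Term.subst, liftSubst_succ]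

theorem subst_liftSubst_inst {n m : ℕ} (A : Fml L (n + 1)) (σ : Fin n → L.Term (Fin m))
    (t : L.Term (Fin m)) : (A.subst (liftSubst σ)).inst t = A.subst (consSubst t σ) := by
  rw [inst_eq, subst_subst]
  congr 1
  funext i
  refine Fin.cases rfl (fun i => ?_) i
  simp [term_subst_subst, Term.subst, term_subst_var]

theorem inst_subst {n m : ℕ} (A : Fml L (n + 1)) (t : L.Term (Fin n))
    (σ : Fin n → L.Term (Fin m)) :
    (A.inst t).subst σ = (A.subst (liftSubst σ)).inst (t.subst σ) := by
  rw [subst_liftSubst_inst, inst_eq, subst_subst]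
  congr 1
  funext i
  refine Fin.cases rfl (fun i => rfl) i

/-- The body of `A.shift` under a binder, opened at the fresh variable, is `A`. -/
theorem subst_liftSubst_inst_var {n : ℕ} (A : Fml L (n + 1)) :
    (A.subst (liftSubst (fun i : Fin n => (Term.var i.succ : L.Term _)))).inst (Term.var 0)
      = A := by
  rw [subst_liftSubst_inst]
  convert subst_var A using 2
  funext i
  exact Fin.cases rfl (fun i => rfl) i

theorem liftSubst_onTerm (φ : L →ᴸ L') {n m : ℕ} (σ : Fin n → L.Term (Fin m)) :
    (fun i => φ.onTerm (liftSubst σ i)) = liftSubst (fun i => φ.onTerm (σ i)) := by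
  funext i
  refine Fin.cases rfl (fun i => ?_) i
  simp [onTerm_subst, LHom.onTerm]

theorem map_subst (φ : L →ᴸ L') {n : ℕ} (A : Fml L n) {m : ℕ} (σ : Fin n → L.Term (Fin m)) :
    (A.subst σ).map φ = (A.map φ).subst (fun i => φ.onTerm (σ i)) := by
  induction A generalizing m with
  | rel R ts => simp only [subst, map, onTerm_subst]
  | top => rfl
  | bot => rfl
  | and A B hA hB => simp only [subst, map, hA, hB]
  | or A B hA hB => simp only [subst, map, hA, hB]
  | imp A B hA hB => simp only [subst, map, hA, hB]
  | all A hA => simp only [subst, map, hA, liftSubst_onTerm]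
  | ex A hA => simp only [subst, map, hA, liftSubst_onTerm]

/-- A closed proposition read in a context of `n` variables. -/
def weaken {n : ℕ} (A : Sentence L) : Fml L n := A.subst Fin.elim0

/-- There is no variable to substitute for. This is what lets axioms survive the shift of hypotheses
under a quantifier. -/
theorem weaken_subst {n m : ℕ} (A : Sentence L) (σ : Fin n → L.Term (Fin m)) :
    (A.weaken).subst σ = A.weaken := by
  rw [weaken, subst_subst]
  exact congrArg A.subst (funext fun i => i.elim0)

theorem weaken_zero (A : Sentence L) : (A.weaken : Fml L 0) = A := by
  conv_rhs => rw [← subst_var A]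
  exact congrArg A.subst (funext fun i => i.elim0)

/-- Logical equivalence. -/
def iff {n : ℕ} (A B : Fml L n) : Fml L n := (A.imp B).and (B.imp A)

end Fml

open Fml

/-! ### Structural rules -/

namespace Deriv

variable {n : ℕ} {Γ Δ : Set (Fml L n)} {A B C : Fml L n}

theorem mono (h : Deriv Γ A) (hΓ : Γ ⊆ Δ) : Deriv Δ A := by
  induction h with
  | ax h => exact ax (hΓ h)
  | impI _ ih => exact impI (ih (Set.insert_subset_insert hΓ))
  | impE _ _ ih₁ ih₂ => exact impE (ih₁ hΓ) (ih₂ hΓ)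
  | andI _ _ ih₁ ih₂ => exact andI (ih₁ hΓ) (ih₂ hΓ)
  | andE₁ _ ih => exact andE₁ (ih hΓ)
  | andE₂ _ ih => exact andE₂ (ih hΓ)
  | orI₁ _ ih => exact orI₁ (ih hΓ)
  | orI₂ _ ih => exact orI₂ (ih hΓ)
  | orE _ _ _ ih₁ ih₂ ih₃ =>
    exact orE (ih₁ hΓ) (ih₂ (Set.insert_subset_insert hΓ)) (ih₃ (Set.insert_subset_insert hΓ))
  | topI => exact topI
  | botE _ ih => exact botE (ih hΓ)
  | allI _ ih => exact allI (ih (Set.image_mono hΓ))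
  | allE t _ ih => exact allE t (ih hΓ)
  | exI t _ ih => exact exI t (ih hΓ)
  | exE _ _ ih₁ ih₂ => exact exE (ih₁ hΓ) (ih₂ (Set.insert_subset_insert (Set.image_mono hΓ)))

theorem weak (h : Deriv Γ A) : Deriv (insert B Γ) A := h.mono (Set.subset_insert _ _)

theorem hyp : Deriv (insert A Γ) A := ax (Set.mem_insert _ _)

theorem substImage_shift {m : ℕ} (σ : Fin n → L.Term (Fin m)) (Γ : Set (Fml L n)) :
    (fun C => C.subst (liftSubst σ)) '' (Fml.shift '' Γ)
      = Fml.shift '' ((fun C => C.subst σ) '' Γ) := by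
  simp only [Set.image_image, shift_subst_liftSubst]

/-- The target context varies in the induction, because the quantifier rules call the induction
hypothesis at `liftSubst σ`. -/
protected theorem subst (h : Deriv Γ A) {m : ℕ} (σ : Fin n → L.Term (Fin m)) :
    Deriv ((fun C => C.subst σ) '' Γ) (A.subst σ) := by
  induction h generalizing m with
  | ax h => exact ax ⟨_, h, rfl⟩
  | impI _ ih =>
    have := ih σ
    rw [Set.image_insert_eq] at this
    exact impI this
  | impE _ _ ih₁ ih₂ => exact impE (ih₁ σ) (ih₂ σ)
  | andI _ _ ih₁ ih₂ => exact andI (ih₁ σ) (ih₂ σ)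
  | andE₁ _ ih => exact andE₁ (ih σ)
  | andE₂ _ ih => exact andE₂ (ih σ)
  | orI₁ _ ih => exact orI₁ (ih σ)
  | orI₂ _ ih => exact orI₂ (ih σ)
  | orE _ _ _ ih₁ ih₂ ih₃ =>
    have h₂ := ih₂ σ
    have h₃ := ih₃ σ
    rw [Set.image_insert_eq] at h₂ h₃
    exact orE (ih₁ σ) h₂ h₃
  | topI => exact topI
  | botE _ ih => exact botE (ih σ)
  | allI _ ih =>
    have := ih (liftSubst σ)
    rw [substImage_shift] at this
    exact allI this
  | allE t _ ih =>
    rw [inst_subst]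
    exact allE _ (ih σ)
  | exI t _ ih =>
    have := ih σ
    rw [inst_subst] at this
    exact exI _ this
  | exE _ _ ih₁ ih₂ =>
    have := ih₂ (liftSubst σ)
    rw [Set.image_insert_eq, substImage_shift, shift_subst_liftSubst] at this
    exact exE (ih₁ σ) this

theorem shift (h : Deriv Γ A) : Deriv (Fml.shift '' Γ) A.shift := h.subst _

theorem cut_insert (h : ∀ C ∈ Γ, Deriv Δ C) : ∀ C ∈ insert A Γ, Deriv (insert A Δ) C := by
  rintro C (rfl | hC)
  · exact hyp
  · exact (h C hC).weak

theorem cut_shift (h : ∀ C ∈ Γ, Deriv Δ C) :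
    ∀ C ∈ Fml.shift '' Γ, Deriv (Fml.shift '' Δ) C := by
  rintro _ ⟨C, hC, rfl⟩
  exact (h C hC).shift

/-- Since `Γ` may be infinite, its members cannot be discharged one by one with `impI`; the
derivation is rebuilt over `Δ` instead. -/
theorem cut (h : Deriv Γ A) (hΔ : ∀ C ∈ Γ, Deriv Δ C) : Deriv Δ A := by
  induction h with
  | ax h => exact hΔ _ h
  | impI _ ih => exact impI (ih (cut_insert hΔ))
  | impE _ _ ih₁ ih₂ => exact impE (ih₁ hΔ) (ih₂ hΔ)
  | andI _ _ ih₁ ih₂ => exact andI (ih₁ hΔ) (ih₂ hΔ)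
  | andE₁ _ ih => exact andE₁ (ih hΔ)
  | andE₂ _ ih => exact andE₂ (ih hΔ)
  | orI₁ _ ih => exact orI₁ (ih hΔ)
  | orI₂ _ ih => exact orI₂ (ih hΔ)
  | orE _ _ _ ih₁ ih₂ ih₃ => exact orE (ih₁ hΔ) (ih₂ (cut_insert hΔ)) (ih₃ (cut_insert hΔ))
  | topI => exact topI
  | botE _ ih => exact botE (ih hΔ)
  | allI _ ih => exact allI (ih (cut_shift hΔ))
  | allE t _ ih => exact allE t (ih hΔ)
  | exI t _ ih => exact exI t (ih hΔ)
  | exE _ _ ih₁ ih₂ => exact exE (ih₁ hΔ) (ih₂ (cut_insert (cut_shift hΔ)))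

/-- Weakening a derivation of a universally quantified proposition by a fresh variable. -/
theorem allE_shift {A : Fml L (n + 1)} (h : Deriv Γ A.all) : Deriv (Fml.shift '' Γ) A := by
  have := allE (Term.var 0) h.shift
  rwa [subst_liftSubst_inst_var] at this

/-- The generic instance of an existential proposition. -/
theorem exI_shift {A : Fml L (n + 1)} {Γ : Set (Fml L (n + 1))} (h : Deriv Γ A) :
    Deriv Γ A.ex.shift := by
  refine exI (Term.var 0) ?_
  rwa [subst_liftSubst_inst_var]

/-! ### Equivalences -/

theorem iff_refl : Deriv Γ (A.iff A) := andI (impI hyp) (impI hyp)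

theorem iff_mp (h : Deriv Γ (A.iff B)) (hA : Deriv Γ A) : Deriv Γ B := impE (andE₁ h) hA

theorem iff_mpr (h : Deriv Γ (A.iff B)) (hB : Deriv Γ B) : Deriv Γ A := impE (andE₂ h) hB

theorem iff_intro (h₁ : Deriv (insert A Γ) B) (h₂ : Deriv (insert B Γ) A) :
    Deriv Γ (A.iff B) := andI (impI h₁) (impI h₂)

theorem iff_trans (h : Deriv Γ (A.iff B)) (h' : Deriv Γ (B.iff C)) : Deriv Γ (A.iff C) :=
  iff_intro (h'.weak.iff_mp (h.weak.iff_mp hyp)) (h.weak.iff_mpr (h'.weak.iff_mpr hyp))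

variable {A' B' : Fml L n}

theorem iff_and (h : Deriv Γ (A.iff A')) (h' : Deriv Γ (B.iff B')) :
    Deriv Γ ((A.and B).iff (A'.and B')) :=
  iff_intro (andI (h.weak.iff_mp (andE₁ hyp)) (h'.weak.iff_mp (andE₂ hyp)))
    (andI (h.weak.iff_mpr (andE₁ hyp)) (h'.weak.iff_mpr (andE₂ hyp)))

theorem iff_or (h : Deriv Γ (A.iff A')) (h' : Deriv Γ (B.iff B')) :
    Deriv Γ ((A.or B).iff (A'.or B')) :=
  iff_intro (orE hyp (orI₁ (h.weak.weak.iff_mp hyp)) (orI₂ (h'.weak.weak.iff_mp hyp)))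
    (orE hyp (orI₁ (h.weak.weak.iff_mpr hyp)) (orI₂ (h'.weak.weak.iff_mpr hyp)))

theorem iff_imp (h : Deriv Γ (A.iff A')) (h' : Deriv Γ (B.iff B')) :
    Deriv Γ ((A.imp B).iff (A'.imp B')) :=
  iff_intro (impI (h'.weak.weak.iff_mp (impE hyp.weak (h.weak.weak.iff_mpr hyp))))
    (impI (h'.weak.weak.iff_mpr (impE hyp.weak (h.weak.weak.iff_mp hyp))))

theorem iff_all {A A' : Fml L (n + 1)} (h : Deriv (Fml.shift '' Γ) (A.iff A')) :
    Deriv Γ (A.all.iff A'.all) := by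
  have hs : ∀ B, Fml.shift '' Γ ⊆ Fml.shift '' (insert B Γ) :=
    fun B => Set.image_mono (Set.subset_insert _ _)
  exact iff_intro (allI (iff_mp (h.mono (hs _)) (allE_shift hyp)))
    (allI (iff_mpr (h.mono (hs _)) (allE_shift hyp)))

theorem iff_ex {A A' : Fml L (n + 1)} (h : Deriv (Fml.shift '' Γ) (A.iff A')) :
    Deriv Γ (A.ex.iff A'.ex) := by
  have hs : ∀ B C, Fml.shift '' Γ ⊆ insert C (Fml.shift '' (insert B Γ)) :=
    fun B C => (Set.image_mono (Set.subset_insert _ _)).trans (Set.subset_insert _ _)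
  exact iff_intro (exE hyp (exI_shift (iff_mp (h.mono (hs _ _)) hyp)))
    (exE hyp (exI_shift (iff_mpr (h.mono (hs _ _)) hyp)))

end Deriv

/-! ### Theories in a context -/

/-- All the axioms of the theory `T` are derivable from `Γ`. -/
def Extends {n : ℕ} (Γ : Set (Fml L n)) (T : Set (Sentence L)) : Prop :=
  ∀ A ∈ T, Deriv Γ A.weaken

namespace Extends

variable {n : ℕ} {Γ Δ : Set (Fml L n)} {T U : Set (Sentence L)}

theorem mono (h : Extends Γ T) (hΓ : Γ ⊆ Δ) : Extends Δ T := fun A hA => (h A hA).mono hΓ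

theorem weak (h : Extends Γ T) {B : Fml L n} : Extends (insert B Γ) T :=
  h.mono (Set.subset_insert _ _)

/-- Because axioms are closed, `Extends` passes to contexts with a fresh variable. Lemmas assuming
only `Extends Γ T` therefore apply at any depth under quantifiers and hypotheses. -/
theorem shift (h : Extends Γ T) : Extends (Fml.shift '' Γ) T := fun A hA => by
  have := (h A hA).shift
  rwa [shift_eq, weaken_subst] at this

theorem anti (h : Extends Γ T) (hT : U ⊆ T) : Extends Γ U := fun A hA => h A (hT hA)

theorem self (T : Set (Sentence L)) : Extends T T := fun A hA => by
  rw [weaken_zero]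
  exact .ax hA

theorem provable {Γ : Set (Sentence L)} (h : Extends Γ T) {A : Sentence L} (hA : Provable T A) :
    Deriv Γ A := hA.cut fun C hC => by
  have := h C hC
  rwa [weaken_zero] at this

theorem trans {U : Set (Sentence L)} (h : Extends Γ T) (hT : Extends T U) : Extends Γ U := by
  intro A hA
  -- Substituting along `Fin.elim0` moves the closed derivation into the context of `n` variables.
  refine ((hT A hA).subst Fin.elim0).cut ?_ |> fun h' => by rwa [weaken_subst] at h'
  rintro _ ⟨C, hC, rfl⟩
  exact h C hC

end Extends

/-- Instantiation of a universal closure. -/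
theorem Deriv.of_close {k : ℕ} {A : Fml L k} {n : ℕ} {Γ : Set (Fml L n)}
    (h : Deriv Γ A.close.weaken) (σ : Fin k → L.Term (Fin n)) : Deriv Γ (A.subst σ) := by
  induction k with
  | zero =>
    rwa [show σ = Fin.elim0 from funext fun i => i.elim0]
  | succ k ih =>
    -- The innermost quantifier of `close` binds variable `0`: the others are instantiated by the
    -- induction hypothesis for `A.all`.
    have := Deriv.allE (σ 0) (ih (A := A.all) h (fun i => σ i.succ))
    rw [subst_liftSubst_inst] at this
    convert this using 2
    funext i
    exact Fin.cases rfl (fun i => rfl) i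

theorem Extends.spec {n : ℕ} {Γ : Set (Fml L n)} {T : Set (Sentence L)} (h : Extends Γ T)
    {k : ℕ} {A : Fml L k} (hA : A.close ∈ T) (σ : Fin k → L.Term (Fin n)) :
    Deriv Γ (A.subst σ) := (h _ hA).of_close σ

/-- Generalization to the universal closure. -/
theorem Deriv.close {k : ℕ} {A : Fml L k} {T : Set (Sentence L)}
    (h : ∀ Γ : Set (Fml L k), Extends Γ T → Deriv Γ A) : Deriv T A.close := by
  induction k with
  | zero => exact h T (.self T)
  | succ k ih => exact ih fun Γ hΓ => .allI (h _ hΓ.shift)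

/-! ### Terms and equations -/

@[simp] theorem subst_v {n m : ℕ} (i : Fin n) (σ : Fin n → L.Term (Fin m)) :
    (v i : L.Term (Fin n)).subst σ = σ i := rfl

theorem subst_vec_two {n m : ℕ} (t u : L.Term (Fin n)) (σ : Fin n → L.Term (Fin m)) :
    (fun i : Fin 2 => ((![t, u] : Fin 2 → L.Term (Fin n)) i).subst σ)
      = ![t.subst σ, u.subst σ] := by
  funext i
  fin_cases i <;> rfl

theorem subst_vec_one {n m : ℕ} (t : L.Term (Fin n)) (σ : Fin n → L.Term (Fin m)) :
    (fun i : Fin 1 => ((![t] : Fin 1 → L.Term (Fin n)) i).subst σ) = ![t.subst σ] := by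
  funext i
  fin_cases i
  rfl

section

variable [ArithSymbols L] {n m : ℕ} (t u : L.Term (Fin n)) (σ : Fin n → L.Term (Fin m))

@[simp] theorem subst_zeroT : (zeroT : L.Term (Fin n)).subst σ = zeroT :=
  congrArg (Term.func _) (funext fun i => i.elim0)

@[simp] theorem subst_succT : (succT t).subst σ = succT (t.subst σ) :=
  congrArg (Term.func _) (subst_vec_one t σ)

@[simp] theorem subst_predT : (predT t).subst σ = predT (t.subst σ) :=
  congrArg (Term.func _) (subst_vec_one t σ)

@[simp] theorem subst_addT : (addT t u).subst σ = addT (t.subst σ) (u.subst σ) :=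
  congrArg (Term.func _) (subst_vec_two t u σ)

@[simp] theorem subst_mulT : (mulT t u).subst σ = mulT (t.subst σ) (u.subst σ) :=
  congrArg (Term.func _) (subst_vec_two t u σ)

@[simp] theorem subst_eqF : (eqF t u).subst σ = eqF (t.subst σ) (u.subst σ) :=
  congrArg (Fml.rel _) (subst_vec_two t u σ)

theorem atSucc_eq (P : Fml L (n + 1)) :
    atSucc P = P.subst (consSubst (succT (v 0)) (fun i => v i.succ)) := rfl

end

@[simp] theorem subst_natF {n m : ℕ} (t : LN.Term (Fin n)) (σ : Fin n → LN.Term (Fin m)) :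
    (natF t).subst σ = natF (t.subst σ) :=
  congrArg (Fml.rel _) (subst_vec_one t σ)

@[simp] theorem subst_nullF {n m : ℕ} (t : LN.Term (Fin n)) (σ : Fin n → LN.Term (Fin m)) :
    (nullF t).subst σ = nullF (t.subst σ) :=
  congrArg (Fml.rel _) (subst_vec_one t σ)

variable (L) in
/-- The axioms of equality and the defining axioms of `Pred`, `+` and `×`. -/
def EqDef [ArithSymbols L] : Set (Sentence L) := {A | EqAxiom L A ∨ DefAxiom L A}

theorem HAPredFull.eqDef : EqDef LPred ⊆ HAPredFull := by
  rintro A (h | h)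
  · exact .inl (.eqAx h)
  · exact .inl (.defAx h)

theorem HAPred.eqDef : EqDef LPred ⊆ HAPred := by
  rintro A (h | h)
  · exact .inl (.eqAx h)
  · exact .inl (.defAx h)

theorem HAN.mem {A : Sentence LN} (h : HANAxiom A) : A ∈ HAN := h

theorem HAN.eqDef : EqDef LN ⊆ HAN := by
  rintro A (h | h)
  · exact .eqAx h
  · exact .defAx h

namespace Extends

variable [ArithSymbols L] {n : ℕ} {Γ : Set (Fml L n)} {t t' u u' s : L.Term (Fin n)}

theorem eq_refl (h : Extends Γ (EqDef L)) (t : L.Term (Fin n)) : Deriv Γ (eqF t t) := by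
  simpa [Fml.subst] using h.spec (A := eqF (v 0) (v 0)) (.inl .refl) ![t]

theorem eq_symm (h : Extends Γ (EqDef L)) (e : Deriv Γ (eqF t u)) : Deriv Γ (eqF u t) := by
  -- Instances are listed from variable `0`, the last one quantified, hence in the reverse of the
  -- order in which the axiom is read.
  have := h.spec (A := (eqF (v 1) (v 0)).imp (eqF (v 0) (v 1))) (.inl .symm) ![u, t]
  simp [Fml.subst] at this
  exact this.impE e

theorem eq_trans (h : Extends Γ (EqDef L)) (e : Deriv Γ (eqF t u)) (e' : Deriv Γ (eqF u s)) :
    Deriv Γ (eqF t s) := by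
  have := h.spec (A := (eqF (v 2) (v 1)).imp ((eqF (v 1) (v 0)).imp (eqF (v 2) (v 0))))
    (.inl .trans) ![s, u, t]
  simp [Fml.subst] at this
  exact (this.impE e).impE e'

theorem succ_congr (h : Extends Γ (EqDef L)) (e : Deriv Γ (eqF t u)) :
    Deriv Γ (eqF (succT t) (succT u)) := by
  have := h.spec (A := (eqF (v 1) (v 0)).imp (eqF (succT (v 1)) (succT (v 0))))
    (.inl .succ) ![u, t]
  simp [Fml.subst] at this
  exact this.impE e

theorem pred_congr (h : Extends Γ (EqDef L)) (e : Deriv Γ (eqF t u)) :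
    Deriv Γ (eqF (predT t) (predT u)) := by
  have := h.spec (A := (eqF (v 1) (v 0)).imp (eqF (predT (v 1)) (predT (v 0))))
    (.inl .pred) ![u, t]
  simp [Fml.subst] at this
  exact this.impE e

theorem add_congr (h : Extends Γ (EqDef L)) (e : Deriv Γ (eqF t t')) (e' : Deriv Γ (eqF u u')) :
    Deriv Γ (eqF (addT t u) (addT t' u')) := by
  have := h.spec (A := (eqF (v 3) (v 2)).imp ((eqF (v 1) (v 0)).imp
    (eqF (addT (v 3) (v 1)) (addT (v 2) (v 0))))) (.inl .add) ![u', u, t', t]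
  simp [Fml.subst] at this
  exact (this.impE e).impE e'

theorem mul_congr (h : Extends Γ (EqDef L)) (e : Deriv Γ (eqF t t')) (e' : Deriv Γ (eqF u u')) :
    Deriv Γ (eqF (mulT t u) (mulT t' u')) := by
  have := h.spec (A := (eqF (v 3) (v 2)).imp ((eqF (v 1) (v 0)).imp
    (eqF (mulT (v 3) (v 1)) (mulT (v 2) (v 0))))) (.inl .mul) ![u', u, t', t]
  simp [Fml.subst] at this
  exact (this.impE e).impE e'

theorem pred_zero (h : Extends Γ (EqDef L)) : Deriv Γ (eqF (predT zeroT) zeroT) := by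
  simpa using h.spec (A := eqF (predT zeroT) zeroT) (.inr .predZero) Fin.elim0

theorem pred_succ (h : Extends Γ (EqDef L)) (t : L.Term (Fin n)) :
    Deriv Γ (eqF (predT (succT t)) t) := by
  simpa using h.spec (A := eqF (predT (succT (v 0))) (v 0)) (.inr .predSucc) ![t]

theorem zero_add (h : Extends Γ (EqDef L)) (t : L.Term (Fin n)) :
    Deriv Γ (eqF (addT zeroT t) t) := by
  simpa using h.spec (A := eqF (addT zeroT (v 0)) (v 0)) (.inr .zeroAdd) ![t]

theorem succ_add (h : Extends Γ (EqDef L)) (t u : L.Term (Fin n)) :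
    Deriv Γ (eqF (addT (succT t) u) (succT (addT t u))) := by
  simpa using h.spec (A := eqF (addT (succT (v 1)) (v 0)) (succT (addT (v 1) (v 0))))
    (.inr .succAdd) ![u, t]

theorem zero_mul (h : Extends Γ (EqDef L)) (t : L.Term (Fin n)) :
    Deriv Γ (eqF (mulT zeroT t) zeroT) := by
  simpa using h.spec (A := eqF (mulT zeroT (v 0)) zeroT) (.inr .zeroMul) ![t]

theorem succ_mul (h : Extends Γ (EqDef L)) (t u : L.Term (Fin n)) :
    Deriv Γ (eqF (mulT (succT t) u) (addT (mulT t u) u)) := by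
  simpa using h.spec (A := eqF (mulT (succT (v 1)) (v 0)) (addT (mulT (v 1) (v 0)) (v 0)))
    (.inr .succMul) ![u, t]

end Extends

/-! ### Closure of `N` under the function symbols -/

namespace Extends

variable {n : ℕ} {Γ : Set (Fml LN n)} {t u : LN.Term (Fin n)}

theorem nat_congr (h : Extends Γ HAN) (e : Deriv Γ (eqF t u)) (ht : Deriv Γ (natF t)) :
    Deriv Γ (natF u) := by
  have := h.spec (k := 2) (A := (eqF (v 1) (v 0)).imp ((natF (v 1)).imp (natF (v 0)))) (HAN.mem .eqNat) ![u, t]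
  simp [Fml.subst] at this
  exact (this.impE e).impE ht

/-- `N` is invariant under replacing a term by an equal one. -/
theorem nat_congr' (h : Extends Γ HAN) (e : Deriv Γ (eqF u t)) (ht : Deriv Γ (natF t)) :
    Deriv Γ (natF u) := h.nat_congr ((h.anti HAN.eqDef).eq_symm e) ht

theorem nat_zero (h : Extends Γ HAN) : Deriv Γ (natF zeroT) := by
  simpa using h.spec (k := 0) (A := natF zeroT) (HAN.mem .natZero) Fin.elim0

theorem nat_succ (h : Extends Γ HAN) (ht : Deriv Γ (natF t)) : Deriv Γ (natF (succT t)) := by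
  have := h.spec (k := 1) (A := (natF (v 0)).imp (natF (succT (v 0)))) (HAN.mem .natSucc) ![t]
  simp [Fml.subst] at this
  exact this.impE ht

/-- The induction axiom as a rule. The step is required in every `Δ` above the shifted context, so
side hypotheses from `Γ` remain available in it. -/
theorem nat_ind (h : Extends Γ HAN) (P : Fml LN (n + 1)) (h0 : Deriv Γ (P.inst zeroT))
    (hs : ∀ Δ, Extends Δ HAN → Fml.shift '' Γ ⊆ Δ → Deriv Δ (natF (v 0)) → Deriv Δ P →
      Deriv Δ (atSucc P)) (ht : Deriv Γ (natF t)) : Deriv Γ (P.inst t) := by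
  have hi := h.spec (HAN.mem (.ind P)) Term.var
  rw [subst_var] at hi
  have := ((hi.impE h0).impE (.allI (.impI (.impI (hs _ h.shift.weak.weak
    ((Set.subset_insert _ _).trans (Set.subset_insert _ _)) Deriv.hyp.weak .hyp))))).allE t
  simp only [inst_eq, Fml.subst, subst_natF, subst_v, consSubst_zero] at this
  exact this.impE ht

/-- In the successor case `Pred(S(x)) = x`, so the premise `N(x)` of the HA_N scheme is what is
needed rather than the induction hypothesis. -/
theorem nat_pred (h : Extends Γ HAN) (ht : Deriv Γ (natF t)) : Deriv Γ (natF (predT t)) := by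
  have := h.nat_ind (natF (predT (v 0))) ?_ ?_ ht
  · simpa [inst_eq] using this
  · simpa [inst_eq] using h.nat_congr' (h.anti HAN.eqDef).pred_zero h.nat_zero
  · intro Δ hΔ _ h0 _
    simpa [atSucc_eq] using hΔ.nat_congr' ((hΔ.anti HAN.eqDef).pred_succ _) h0

/-- The induction is on the first argument, the one on which the axioms for `+` recurse. -/
theorem nat_add (h : Extends Γ HAN) (ht : Deriv Γ (natF t)) (hu : Deriv Γ (natF u)) :
    Deriv Γ (natF (addT t u)) := by
  have := h.nat_ind (natF (addT (v 0) (u.subst fun i => v i.succ))) ?_ ?_ ht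
  · simpa [inst_eq, term_subst_subst, term_subst_var] using this
  · simpa [inst_eq, term_subst_subst, term_subst_var] using
      h.nat_congr' ((h.anti HAN.eqDef).zero_add _) hu
  · intro Δ hΔ _ _ hP
    simpa [atSucc_eq, term_subst_subst] using
      hΔ.nat_congr' ((hΔ.anti HAN.eqDef).succ_add _ _) (hΔ.nat_succ hP)

theorem nat_mul (h : Extends Γ HAN) (ht : Deriv Γ (natF t)) (hu : Deriv Γ (natF u)) :
    Deriv Γ (natF (mulT t u)) := by
  have := h.nat_ind (natF (mulT (v 0) (u.subst fun i => v i.succ))) ?_ ?_ ht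
  · simpa [inst_eq, term_subst_subst, term_subst_var] using this
  · simpa [inst_eq, term_subst_subst, term_subst_var] using
      h.nat_congr' ((h.anti HAN.eqDef).zero_mul _) h.nat_zero
  · intro Δ hΔ hs _ hP
    -- The recursion `S(x) × u = x × u + u` needs `N(u)` inside the induction step.
    have hu' := hu.shift.mono hs
    rw [shift_eq, subst_natF] at hu'
    simpa [atSucc_eq, term_subst_subst] using
      hΔ.nat_congr' ((hΔ.anti HAN.eqDef).succ_mul _ _) (hΔ.nat_add hP hu')

end Extends

/-! ### Terms read in a larger language -/

theorem onTerm_vec_two (φ : L →ᴸ L') {n : ℕ} (t u : L.Term (Fin n)) :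
    (fun i : Fin 2 => φ.onTerm ((![t, u] : Fin 2 → L.Term (Fin n)) i))
      = ![φ.onTerm t, φ.onTerm u] := by
  funext i
  fin_cases i <;> rfl

theorem onTerm_vec_one (φ : L →ᴸ L') {n : ℕ} (t : L.Term (Fin n)) :
    (fun i : Fin 1 => φ.onTerm ((![t] : Fin 1 → L.Term (Fin n)) i)) = ![φ.onTerm t] := by
  funext i
  fin_cases i
  rfl

section

variable {n : ℕ} (t u : LPred.Term (Fin n))

@[simp] theorem inclN_zeroT : inclN.onTerm (zeroT : LPred.Term (Fin n)) = zeroT :=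
  congrArg (Term.func _) (funext fun i => i.elim0)

@[simp] theorem inclN_succT : inclN.onTerm (succT t) = succT (inclN.onTerm t) :=
  congrArg (Term.func _) (onTerm_vec_one inclN t)

@[simp] theorem inclN_predT : inclN.onTerm (predT t) = predT (inclN.onTerm t) :=
  congrArg (Term.func _) (onTerm_vec_one inclN t)

@[simp] theorem inclN_addT :
    inclN.onTerm (addT t u) = addT (inclN.onTerm t) (inclN.onTerm u) :=
  congrArg (Term.func _) (onTerm_vec_two inclN t u)

@[simp] theorem inclN_mulT :
    inclN.onTerm (mulT t u) = mulT (inclN.onTerm t) (inclN.onTerm u) :=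
  congrArg (Term.func _) (onTerm_vec_two inclN t u)

@[simp] theorem relativize_eqF :
    relativize (eqF t u) = eqF (inclN.onTerm t) (inclN.onTerm u) :=
  congrArg (Fml.rel _) (onTerm_vec_two inclN t u)

end

/-- Induction on the terms of the language of HA_Pred. -/
theorem LPred_term_ind {n : ℕ} {motive : LPred.Term (Fin n) → Prop} (var : ∀ i, motive (v i))
    (zero : motive zeroT) (succ : ∀ t, motive t → motive (succT t))
    (pred : ∀ t, motive t → motive (predT t))
    (add : ∀ t u, motive t → motive u → motive (addT t u))
    (mul : ∀ t u, motive t → motive u → motive (mulT t u)) (t : LPred.Term (Fin n)) :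
    motive t := by
  have vec0 : ∀ ts : Fin 0 → LPred.Term (Fin n), ts = ![] := fun ts => Subsingleton.elim _ _
  have vec1 : ∀ ts : Fin 1 → LPred.Term (Fin n), ts = ![ts 0] := fun ts => by
    funext i
    fin_cases i
    rfl
  have vec2 : ∀ ts : Fin 2 → LPred.Term (Fin n), ts = ![ts 0, ts 1] := fun ts => by
    funext i
    fin_cases i <;> rfl
  induction t with
  | var i => exact var i
  | @func l f ts ih =>
    match l, f, ts, ih with
    | _, PredFunc.zero, ts, ih => rw [vec0 ts]; exact zero
    | _, PredFunc.succ, ts, ih => rw [vec1 ts]; exact succ _ (ih 0)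
    | _, PredFunc.pred, ts, ih => rw [vec1 ts]; exact pred _ (ih 0)
    | _, PredFunc.add, ts, ih => rw [vec2 ts]; exact add _ _ (ih 0) (ih 1)
    | _, PredFunc.mul, ts, ih => rw [vec2 ts]; exact mul _ _ (ih 0) (ih 1)

/-- This provides the premise `N(t)` when a relativized quantifier is instantiated by a term `t`. -/
theorem Extends.nat_term {n : ℕ} {Γ : Set (Fml LN n)} (h : Extends Γ HAN)
    (hv : ∀ i, Deriv Γ (natF (v i))) (t : LPred.Term (Fin n)) :
    Deriv Γ (natF (inclN.onTerm t)) := by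
  induction t using LPred_term_ind with
  | var i => exact hv i
  | zero => simpa using h.nat_zero
  | succ t ih => simpa using h.nat_succ ih
  | pred t ih => simpa using h.nat_pred ih
  | add t u iht ihu => simpa using h.nat_add iht ihu
  | mul t u iht ihu => simpa using h.nat_mul iht ihu

/-! ### Soundness of the relativization -/

theorem relativize_subst {n : ℕ} (A : Fml LPred n) {m : ℕ} (σ : Fin n → LPred.Term (Fin m)) :
    relativize (A.subst σ) = (relativize A).subst (fun i => inclN.onTerm (σ i)) := by
  induction A generalizing m with
  | rel R ts => exact map_subst inclN (.rel R ts) σ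
  | top => rfl
  | bot => rfl
  | and A B hA hB => simp only [Fml.subst, relativize, hA, hB]
  | or A B hA hB => simp only [Fml.subst, relativize, hA, hB]
  | imp A B hA hB => simp only [Fml.subst, relativize, hA, hB]
  | all A hA => simp [Fml.subst, relativize, hA, liftSubst_onTerm, v]
  | ex A hA => simp [Fml.subst, relativize, hA, liftSubst_onTerm, v]

theorem relativize_shift {n : ℕ} (A : Fml LPred n) :
    relativize A.shift = (relativize A).shift := relativize_subst _ _

theorem relativize_inst {n : ℕ} (A : Fml LPred (n + 1)) (t : LPred.Term (Fin n)) :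
    relativize (A.inst t) = (relativize A).inst (inclN.onTerm t) := by
  rw [inst_eq, relativize_subst, inst_eq]
  congr 1
  funext i
  exact Fin.cases rfl (fun i => rfl) i

theorem relativize_atSucc {n : ℕ} (A : Fml LPred (n + 1)) :
    relativize (atSucc A) = atSucc (relativize A) := by
  rw [atSucc_eq, relativize_subst, atSucc_eq]
  congr 1
  funext i
  exact Fin.cases (inclN_succT _) (fun i => rfl) i

/-- All the variables of the context satisfy `N`. -/
def NatVars {n : ℕ} (Γ : Set (Fml LN n)) : Prop := ∀ i, Deriv Γ (natF (v i))

theorem NatVars.mono {n : ℕ} {Γ Δ : Set (Fml LN n)} (h : NatVars Γ) (hΓ : Γ ⊆ Δ) : NatVars Δ :=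
  fun i => (h i).mono hΓ

theorem NatVars.weak {n : ℕ} {Γ : Set (Fml LN n)} (h : NatVars Γ) {A : Fml LN n} :
    NatVars (insert A Γ) := h.mono (Set.subset_insert _ _)

theorem NatVars.cons {n : ℕ} {Γ : Set (Fml LN n)} {Δ : Set (Fml LN (n + 1))} (h : NatVars Γ)
    (hs : Fml.shift '' Γ ⊆ Δ) (h0 : Deriv Δ (natF (v 0))) : NatVars Δ :=
  Fin.cases h0 fun i => by
    have := (h i).shift.mono hs
    rwa [shift_eq, subst_natF] at this

/-- Besides the relativized hypotheses, `Δ` carries the axioms of HA_N and `N` for each free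
variable. The rules `allI` and `exE` add `N` of the fresh variable; `allE` and `exI` use `nat_term`.
-/
theorem Deriv.relativize {n : ℕ} {Γ : Set (Fml LPred n)} {A : Fml LPred n} (h : Deriv Γ A)
    {Δ : Set (Fml LN n)} (hΔ : Extends Δ HAN) (hv : NatVars Δ)
    (hΓ : ∀ B ∈ Γ, Deriv Δ (relativize B)) : Deriv Δ (relativize A) := by
  have ins : ∀ {n : ℕ} {Γ : Set (Fml LPred n)} {Δ : Set (Fml LN n)} {A : Fml LPred n},
      (∀ B ∈ Γ, Deriv Δ (HeytingArith.relativize B)) →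
      ∀ B ∈ insert A Γ, Deriv (insert (HeytingArith.relativize A) Δ)
        (HeytingArith.relativize B) := by
    rintro n Γ Δ A h B (rfl | hB)
    · exact hyp
    · exact (h B hB).weak
  have shi : ∀ {n : ℕ} {Γ : Set (Fml LPred n)} {Δ : Set (Fml LN n)} {Δ' : Set (Fml LN (n + 1))},
      (∀ B ∈ Γ, Deriv Δ (HeytingArith.relativize B)) → Fml.shift '' Δ ⊆ Δ' →
      ∀ B ∈ Fml.shift '' Γ, Deriv Δ' (HeytingArith.relativize B) := by
    rintro n Γ Δ Δ' h hs _ ⟨B, hB, rfl⟩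
    rw [relativize_shift]
    exact (h B hB).shift.mono hs
  induction h with
  | ax h => exact hΓ _ h
  | impI _ ih => exact impI (ih hΔ.weak hv.weak (ins hΓ))
  | impE _ _ ih₁ ih₂ => exact impE (ih₁ hΔ hv hΓ) (ih₂ hΔ hv hΓ)
  | andI _ _ ih₁ ih₂ => exact andI (ih₁ hΔ hv hΓ) (ih₂ hΔ hv hΓ)
  | andE₁ _ ih => exact andE₁ (ih hΔ hv hΓ)
  | andE₂ _ ih => exact andE₂ (ih hΔ hv hΓ)
  | orI₁ _ ih => exact orI₁ (ih hΔ hv hΓ)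
  | orI₂ _ ih => exact orI₂ (ih hΔ hv hΓ)
  | orE _ _ _ ih₁ ih₂ ih₃ =>
    exact orE (ih₁ hΔ hv hΓ) (ih₂ hΔ.weak hv.weak (ins hΓ)) (ih₃ hΔ.weak hv.weak (ins hΓ))
  | topI => exact topI
  | botE _ ih => exact botE (ih hΔ hv hΓ)
  | allI _ ih =>
    exact allI (impI (ih hΔ.shift.weak (hv.cons (Set.subset_insert _ _) hyp)
      (shi hΓ (Set.subset_insert _ _))))
  | allE t _ ih =>
    rw [relativize_inst]
    have := allE (inclN.onTerm t) (ih hΔ hv hΓ)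
    simp only [inst_eq, Fml.subst, subst_natF, subst_v, consSubst_zero] at this
    exact this.impE (hΔ.nat_term hv t)
  | exI t _ ih =>
    refine exI (inclN.onTerm t) ?_
    simp only [inst_eq, Fml.subst, subst_natF, subst_v, consSubst_zero]
    have := ih hΔ hv hΓ
    rw [relativize_inst] at this
    exact andI (hΔ.nat_term hv t) this
  | @exE n Γ A B _ _ ih₁ ih₂ =>
    refine exE (ih₁ hΔ hv hΓ) ?_
    rw [← relativize_shift]
    refine ih₂ hΔ.shift.weak (hv.cons (Set.subset_insert _ _) (andE₁ hyp)) ?_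
    rintro C (rfl | hC)
    · exact andE₂ hyp
    · exact shi hΓ (Set.subset_insert _ _) C hC

/-- A proposition whose relativization holds of all the natural numbers has a universal closure
whose relativization is provable. -/
theorem provable_relativize_close {n : ℕ} {A : Fml LPred n}
    (h : ∀ Γ : Set (Fml LN n), Extends Γ HAN → NatVars Γ → Deriv Γ (relativize A)) :
    Provable HAN (relativize A.close) := by
  induction n with
  | zero => exact h HAN (.self HAN) fun i => i.elim0
  | succ n ih =>
    exact ih fun Γ hΓ hv => .allI (.impI (h _ hΓ.shift.weak (hv.cons (Set.subset_insert _ _) .hyp)))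

/-! ### Relativized axioms of HA_Pred -/

/-- The matrix is quantifier free, so relativization only adds premises `N(x)` to an axiom that HA_N
asserts of all objects. -/
theorem provable_relativize_eqAxiom {A : Sentence LPred} (hA : EqAxiom LPred A) :
    Provable HAN (relativize A) := by
  cases hA with
  | refl =>
    refine provable_relativize_close (n := 1) fun Γ h _ => ?_
    simpa using (h.anti HAN.eqDef).eq_refl _
  | symm =>
    refine provable_relativize_close (n := 2) fun Γ h _ => ?_
    simpa [relativize] using .impI ((h.weak.anti HAN.eqDef).eq_symm .hyp)
  | trans =>
    refine provable_relativize_close (n := 3) fun Γ h _ => ?_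
    simpa [relativize] using
      .impI (.impI ((h.weak.weak.anti HAN.eqDef).eq_trans Deriv.hyp.weak .hyp))
  | succ =>
    refine provable_relativize_close (n := 2) fun Γ h _ => ?_
    simpa [relativize] using .impI ((h.weak.anti HAN.eqDef).succ_congr .hyp)
  | add =>
    refine provable_relativize_close (n := 4) fun Γ h _ => ?_
    simpa [relativize] using
      .impI (.impI ((h.weak.weak.anti HAN.eqDef).add_congr Deriv.hyp.weak .hyp))
  | mul =>
    refine provable_relativize_close (n := 4) fun Γ h _ => ?_
    simpa [relativize] using
      .impI (.impI ((h.weak.weak.anti HAN.eqDef).mul_congr Deriv.hyp.weak .hyp))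
  | pred =>
    refine provable_relativize_close (n := 2) fun Γ h _ => ?_
    simpa [relativize] using .impI ((h.weak.anti HAN.eqDef).pred_congr .hyp)

theorem provable_relativize_defAxiom {A : Sentence LPred} (hA : DefAxiom LPred A) :
    Provable HAN (relativize A) := by
  cases hA with
  | predZero =>
    refine provable_relativize_close (n := 0) (A := eqF (predT zeroT) zeroT) fun Γ h _ => ?_
    simpa using (h.anti HAN.eqDef).pred_zero
  | predSucc =>
    refine provable_relativize_close (n := 1) fun Γ h _ => ?_
    simpa using (h.anti HAN.eqDef).pred_succ _
  | zeroAdd =>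
    refine provable_relativize_close (n := 1) fun Γ h _ => ?_
    simpa using (h.anti HAN.eqDef).zero_add _
  | succAdd =>
    refine provable_relativize_close (n := 2) fun Γ h _ => ?_
    simpa using (h.anti HAN.eqDef).succ_add _ _
  | zeroMul =>
    refine provable_relativize_close (n := 1) fun Γ h _ => ?_
    simpa using (h.anti HAN.eqDef).zero_mul _
  | succMul =>
    refine provable_relativize_close (n := 2) fun Γ h _ => ?_
    simpa using (h.anti HAN.eqDef).succ_mul _ _

/-- Relativization commutes with the substitutions of `0` and `S(y)`, so the relativized instance
for `P` is exactly `indNF (relativize P)`. -/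
theorem provable_relativize_indF {n : ℕ} (P : Fml LPred (n + 1)) :
    Provable HAN (relativize (indF P).close) := by
  refine provable_relativize_close fun Γ h _ => ?_
  have := h.spec (HAN.mem (.ind (relativize P))) Term.var
  rw [subst_var, indNF] at this
  simpa only [indF, relativize, relativize_inst, relativize_atSucc, inclN_zeroT] using this

theorem Extends.null_congr {n : ℕ} {Γ : Set (Fml LN n)} {t u : LN.Term (Fin n)}
    (h : Extends Γ HAN) (e : Deriv Γ (eqF t u)) (ht : Deriv Γ (nullF t)) : Deriv Γ (nullF u) := by
  have := h.spec (k := 2) (A := (eqF (v 1) (v 0)).imp ((nullF (v 1)).imp (nullF (v 0)))) (HAN.mem .eqNull) ![u, t]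
  simp [Fml.subst] at this
  exact (this.impE e).impE ht

/-- The successor is injective, since `Pred` inverts it. -/
theorem Extends.succ_inj {n : ℕ} {Γ : Set (Fml L n)} [ArithSymbols L] {t u : L.Term (Fin n)}
    (h : Extends Γ (EqDef L)) (e : Deriv Γ (eqF (succT t) (succT u))) : Deriv Γ (eqF t u) :=
  h.eq_trans (h.eq_symm (h.pred_succ t)) (h.eq_trans (h.pred_congr e) (h.pred_succ u))

/-- `0` is not a successor in HA_N. -/
theorem Extends.zero_ne_succ {n : ℕ} {Γ : Set (Fml LN n)} {t : LN.Term (Fin n)}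
    (h : Extends Γ HAN) (e : Deriv Γ (eqF zeroT (succT t))) : Deriv Γ Fml.bot := by
  have h0 := h.spec (k := 0) (A := nullF zeroT) (HAN.mem .nullZero) Fin.elim0
  have h1 := h.spec (k := 1) (A := (nullF (succT (v 0))).neg) (HAN.mem .nullSucc) ![t]
  simp [Fml.subst, Fml.neg] at h0 h1
  -- The equation would carry `Null(0)` over to `Null(S(t))`.
  exact h1.impE (h.null_congr e h0)

theorem provable_relativize {A : Sentence LPred} (hA : Provable HAPredFull A) :
    Provable HAN (relativize A) := by
  refine hA.relativize (.self HAN) (fun i => i.elim0) ?_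
  rintro B (hB | ⟨n, P, rfl⟩)
  · cases hB with
    | eqAx h => exact provable_relativize_eqAxiom h
    | defAx h => exact provable_relativize_defAxiom h
    | succInj =>
      refine provable_relativize_close (n := 2) fun Γ h _ => ?_
      simpa [relativize] using .impI ((h.weak.anti HAN.eqDef).succ_inj .hyp)
    | zeroNeSucc =>
      refine provable_relativize_close (n := 1) fun Γ h _ => ?_
      simpa [relativize, Fml.neg] using .impI (h.weak.zero_ne_succ .hyp)
  · exact provable_relativize_indF P

/-! ### Elimination of `Pred` -/

theorem Extends.of_provable {n : ℕ} {Γ : Set (Fml L n)} {T : Set (Sentence L)} (h : Extends Γ T)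
    {A : Sentence L} (hA : Provable T A) : Deriv Γ A.weaken :=
  h.trans (U := {A}) (by rintro B rfl; rwa [weaken_zero]) A rfl

/-- Consequences of a theory are stable under substitution. -/
theorem Extends.subst_of_forall {k : ℕ} {A : Fml L k} {T : Set (Sentence L)}
    (hA : ∀ Γ : Set (Fml L k), Extends Γ T → Deriv Γ A) {n : ℕ} {Γ : Set (Fml L n)}
    (h : Extends Γ T) (σ : Fin k → L.Term (Fin n)) : Deriv Γ (A.subst σ) :=
  (h.of_provable (Deriv.close hA)).of_close σ

/-- Induction holds for the propositions which are equivalent to a proposition of the language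
of HA. -/
theorem indF_of_iff {n : ℕ} {P : Fml LPred (n + 1)} {Q : Fml LHA (n + 1)}
    (hPQ : ∀ Γ, Extends Γ HAPred → Deriv Γ (P.iff (Q.map inclPred))) {Γ : Set (Fml LPred n)}
    (h : Extends Γ HAPred) : Deriv Γ (indF P) := by
  have hi := h.spec (.inr ⟨n, Q, rfl⟩) Term.var
  rw [subst_var] at hi
  -- The equivalence is needed at `0` and at `S(y)` too, where it follows by substitution from the
  -- generic one.
  exact Deriv.iff_mpr (.iff_imp (h.subst_of_forall hPQ _) (.iff_imp
    (.iff_all (.iff_imp (hPQ _ h.shift) (h.shift.subst_of_forall hPQ _)))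
    (.iff_all (hPQ _ h.shift)))) hi

/-- `P` is equivalent in HA_Pred to a proposition of the language of HA. -/
def PredElim {n : ℕ} (P : Fml LPred n) : Prop :=
  ∃ Q : Fml LHA n, ∀ Γ, Extends Γ HAPred → Deriv Γ (P.iff (Q.map inclPred))

theorem PredElim.indF {n : ℕ} {P : Fml LPred (n + 1)} (hP : PredElim P) {Γ : Set (Fml LPred n)}
    (h : Extends Γ HAPred) : Deriv Γ (indF P) := indF_of_iff hP.choose_spec h

namespace PredElim

variable {n : ℕ} {A B : Fml LPred n}

theorem congr (h : ∀ Γ, Extends Γ HAPred → Deriv Γ (A.iff B)) (hB : PredElim B) : PredElim A :=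
  let ⟨Q, hQ⟩ := hB
  ⟨Q, fun Γ hΓ => (h Γ hΓ).iff_trans (hQ Γ hΓ)⟩

protected theorem top : PredElim (Fml.top : Fml LPred n) := ⟨.top, fun _ _ => .iff_refl⟩

protected theorem bot : PredElim (Fml.bot : Fml LPred n) := ⟨.bot, fun _ _ => .iff_refl⟩

protected theorem and (hA : PredElim A) (hB : PredElim B) : PredElim (A.and B) :=
  let ⟨Q, hQ⟩ := hA
  let ⟨R, hR⟩ := hB
  ⟨Q.and R, fun Γ hΓ => (hQ Γ hΓ).iff_and (hR Γ hΓ)⟩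

protected theorem or (hA : PredElim A) (hB : PredElim B) : PredElim (A.or B) :=
  let ⟨Q, hQ⟩ := hA
  let ⟨R, hR⟩ := hB
  ⟨Q.or R, fun Γ hΓ => (hQ Γ hΓ).iff_or (hR Γ hΓ)⟩

protected theorem imp (hA : PredElim A) (hB : PredElim B) : PredElim (A.imp B) :=
  let ⟨Q, hQ⟩ := hA
  let ⟨R, hR⟩ := hB
  ⟨Q.imp R, fun Γ hΓ => (hQ Γ hΓ).iff_imp (hR Γ hΓ)⟩

protected theorem all {A : Fml LPred (n + 1)} (hA : PredElim A) : PredElim A.all :=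
  let ⟨Q, hQ⟩ := hA
  ⟨Q.all, fun _ hΓ => .iff_all (hQ _ hΓ.shift)⟩

protected theorem ex {A : Fml LPred (n + 1)} (hA : PredElim A) : PredElim A.ex :=
  let ⟨Q, hQ⟩ := hA
  ⟨Q.ex, fun _ hΓ => .iff_ex (hQ _ hΓ.shift)⟩

end PredElim

/-- `t` is a term of the language of HA. -/
def IsHATerm {n : ℕ} (t : LPred.Term (Fin n)) : Prop := t ∈ Set.range inclPred.onTerm

namespace IsHATerm

variable {n : ℕ} {t u : LPred.Term (Fin n)}

theorem v (i : Fin n) : IsHATerm (v i) := ⟨.var i, rfl⟩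

theorem zeroT : IsHATerm (zeroT : LPred.Term (Fin n)) :=
  ⟨.func (L := LHA) HAFunc.zero ![], congrArg (Term.func _) (funext fun i => i.elim0)⟩

theorem succT : IsHATerm t → IsHATerm (succT t) := by
  rintro ⟨t, rfl⟩
  exact ⟨.func (L := LHA) HAFunc.succ ![t], congrArg (Term.func _) (onTerm_vec_one inclPred t)⟩

theorem addT : IsHATerm t → IsHATerm u → IsHATerm (addT t u) := by
  rintro ⟨t, rfl⟩ ⟨u, rfl⟩
  exact ⟨.func (L := LHA) HAFunc.add ![t, u],
    congrArg (Term.func _) (onTerm_vec_two inclPred t u)⟩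

theorem mulT : IsHATerm t → IsHATerm u → IsHATerm (mulT t u) := by
  rintro ⟨t, rfl⟩ ⟨u, rfl⟩
  exact ⟨.func (L := LHA) HAFunc.mul ![t, u],
    congrArg (Term.func _) (onTerm_vec_two inclPred t u)⟩

theorem eqF : IsHATerm t → IsHATerm u → PredElim (eqF t u) := by
  rintro ⟨t, rfl⟩ ⟨u, rfl⟩
  refine ⟨.rel (L := LHA) EqRel.eq ![t, u], fun Γ _ => ?_⟩
  rw [show Fml.map inclPred (.rel (L := LHA) EqRel.eq ![t, u]) = HeytingArith.eqF _ _ from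
    congrArg (Fml.rel _) (onTerm_vec_two inclPred t u)]
  exact .iff_refl

end IsHATerm

/-! ### Case distinction on numbers and the graph of `Pred` -/

theorem consSubst_one {n m : ℕ} (t : L.Term (Fin m)) (σ : Fin (n + 1) → L.Term (Fin m)) :
    consSubst t σ 1 = σ 0 := rfl

/-- The term `t` with one more (fresh) variable, the variable `0`. -/
def shiftT {n : ℕ} (t : L.Term (Fin n)) : L.Term (Fin (n + 1)) := t.subst fun i => v i.succ

@[simp] theorem shiftT_subst {n m : ℕ} (t : L.Term (Fin n)) (s : L.Term (Fin m))
    (σ : Fin n → L.Term (Fin m)) : (shiftT t).subst (consSubst s σ) = t.subst σ :=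
  term_subst_subst _ _ _

@[simp] theorem shift_eqF [ArithSymbols L] {n : ℕ} (t u : L.Term (Fin n)) :
    (eqF t u).shift = eqF (shiftT t) (shiftT u) := subst_eqF _ _ _

theorem shiftT_succT [ArithSymbols L] {n : ℕ} (t : L.Term (Fin n)) :
    shiftT (succT t) = succT (shiftT t) := subst_succT _ _

theorem shiftT_predT [ArithSymbols L] {n : ℕ} (t : L.Term (Fin n)) :
    shiftT (predT t) = predT (shiftT t) := subst_predT _ _

theorem Extends.eq_iff [ArithSymbols L] {n : ℕ} {Γ : Set (Fml L n)} {t t' u u' : L.Term (Fin n)}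
    (h : Extends Γ (EqDef L)) (e : Deriv Γ (eqF t t')) (e' : Deriv Γ (eqF u u')) :
    Deriv Γ ((eqF t u).iff (eqF t' u')) :=
  .iff_intro (h.weak.eq_trans (h.weak.eq_symm e.weak) (h.weak.eq_trans .hyp e'.weak))
    (h.weak.eq_trans e.weak (h.weak.eq_trans .hyp (h.weak.eq_symm e'.weak)))

/-- Every number is `0` or a successor. -/
theorem Extends.zero_or_succ {n : ℕ} {Γ : Set (Fml LPred n)} (h : Extends Γ HAPred)
    (t : LPred.Term (Fin n)) :
    Deriv Γ ((eqF t zeroT).or (Fml.ex (eqF (shiftT t) (succT (v 0))))) := by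
  -- The induction proposition has no `Pred`, so the restricted scheme applies to it directly.
  have hP : PredElim ((eqF (v 0) zeroT).or
      (Fml.ex (eqF (v 1) (succT (v 0))) : Fml LPred (n + 1))) :=
    (IsHATerm.eqF (.v _) .zeroT).or (IsHATerm.eqF (.v _) (.succT (.v _))).ex
  have h1 : ∀ σ : Fin (n + 1) → LPred.Term (Fin (n + 1)),
      liftSubst σ 1 = shiftT (σ 0) := fun σ => liftSubst_succ σ 0
  have h1' : ∀ σ : Fin (n + 1) → LPred.Term (Fin n),
      liftSubst σ 1 = shiftT (σ 0) := fun σ => liftSubst_succ σ 0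
  have hi := ((hP.indF h).impE ?_).impE (.allI (.impI ?_))
  · simpa [inst_eq, Fml.subst, h1', v] using hi.allE t
  · simpa [inst_eq, Fml.subst] using Deriv.orI₁ ((h.anti HAPred.eqDef).eq_refl _)
  · simp only [atSucc_eq, Fml.subst, subst_eqF, subst_v, consSubst_zero, h1]
    refine .orI₂ (.exI (v 0) ?_)
    simpa [inst_eq, Fml.subst, v] using (h.shift.weak.anti HAPred.eqDef).eq_refl _

theorem Extends.pred_of_zero [ArithSymbols L] {n : ℕ} {Γ : Set (Fml L n)} {u : L.Term (Fin n)}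
    (h : Extends Γ (EqDef L)) (e : Deriv Γ (eqF u zeroT)) : Deriv Γ (eqF (predT u) zeroT) :=
  h.eq_trans (h.pred_congr e) h.pred_zero

theorem Extends.pred_of_succ [ArithSymbols L] {n : ℕ} {Γ : Set (Fml L n)} {t u : L.Term (Fin n)}
    (h : Extends Γ (EqDef L)) (e : Deriv Γ (eqF u (succT t))) : Deriv Γ (eqF (predT u) t) :=
  h.eq_trans (h.pred_congr e) (h.pred_succ t)

/-- The graph of `Pred`. -/
theorem Extends.eq_pred_iff {n : ℕ} {Γ : Set (Fml LPred n)} (h : Extends Γ HAPred)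
    (t u : LPred.Term (Fin n)) :
    Deriv Γ ((eqF t (predT u)).iff
      (((eqF u zeroT).and (eqF t zeroT)).or (eqF u (succT t)))) := by
  have hE : ∀ {n : ℕ} {Γ : Set (Fml LPred n)}, Extends Γ HAPred → Extends Γ (EqDef LPred) :=
    fun h => h.anti HAPred.eqDef
  refine .iff_intro (.orE (h.weak.zero_or_succ u) (.orI₁ (.andI .hyp ?_)) (.orI₂ (.exE .hyp ?_)))
    (.orE .hyp ?_ ?_)
  · exact (hE h.weak.weak).eq_trans Deriv.hyp.weak ((hE h.weak.weak).pred_of_zero .hyp)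
  -- If `u = S(x)` then `t = Pred(u) = x`, whence `u = S(t)`.
  · have e : ∀ {Γ' : Set (Fml LPred n)} {B}, Extends Γ' HAPred → Deriv Γ' (eqF t (predT u)) →
        Deriv (insert (eqF (shiftT u) (succT (v 0))) (Fml.shift '' insert B Γ'))
          (eqF (shiftT u) (succT (shiftT t))) := by
      intro Γ' B h e
      have h' := hE ((h.weak (B := B)).shift.weak (B := eqF (shiftT u) (succT (v 0))))
      have e' := (e.weak (B := B)).shift.weak (B := eqF (shiftT u) (succT (v 0)))
      rw [shift_eqF, shiftT_predT] at e'
      exact h'.eq_trans .hyp (h'.succ_congr (h'.eq_symm (h'.eq_trans e' (h'.pred_of_succ .hyp))))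
    rw [shift_eqF, shiftT_succT]
    exact e h.weak .hyp
  · exact (hE h.weak.weak).eq_trans (.andE₂ .hyp)
      ((hE h.weak.weak).eq_symm ((hE h.weak.weak).pred_of_zero (.andE₁ .hyp)))
  · exact (hE h.weak.weak).eq_symm ((hE h.weak.weak).pred_of_succ .hyp)

theorem LPred_rel_eq {n k : ℕ} (R : LPred.Relations k) (ts : Fin k → LPred.Term (Fin n)) :
    ∃ t u, Fml.rel R ts = eqF t u := by
  match k, R, ts with
  | _, EqRel.eq, ts =>
    refine ⟨ts 0, ts 1, congrArg (Fml.rel _) (funext fun i => ?_)⟩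
    fin_cases i <;> rfl

/-! ### Unnesting of terms and elimination of `Pred` from propositions -/

namespace PredElim

variable {n : ℕ}

/-- The one-point rule: `P(t)` is equivalent to `∃x (x = t ∧ P(x))`. -/
theorem one_point {P : Fml LPred (n + 1)} {t : LPred.Term (Fin n)} (hP : PredElim P)
    (ht : PredElim (eqF (v 0) (shiftT t)))
    (hc : ∀ Γ, Extends Γ (EqDef LPred) → Deriv Γ (eqF (v 0) (shiftT t)) →
      Deriv Γ (P.iff (P.inst t).shift)) : PredElim (P.inst t) := by
  refine congr (fun Γ hΓ => ?_) (ht.and hP).ex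
  refine .iff_intro (.exI t ?_) (.exE .hyp ?_)
  · have := Deriv.andI ((hΓ.weak (B := P.inst t).anti HAPred.eqDef).eq_refl t) .hyp
    simpa [inst_eq, Fml.subst, term_subst_var] using this
  · exact (hc _ (hΓ.weak.shift.weak.anti HAPred.eqDef) (.andE₁ .hyp)).iff_mp (.andE₂ .hyp)

/-- By induction on `t`, `x = f(t, u)` unfolds to `∃y (y = t ∧ ∃z (z = u ∧ x = f(y, z)))`. The
renaming `ρ` is general because the subterms reappear under these new binders. -/
theorem var_eq (t : LPred.Term (Fin n)) {m : ℕ} (ρ : Fin n → Fin m) (i : Fin m) :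
    PredElim (eqF (v i) (t.subst fun j => v (ρ j))) := by
  have hs : ∀ {m : ℕ} (t : LPred.Term (Fin n)) (ρ : Fin n → Fin m),
      shiftT (t.subst fun j => v (ρ j)) = t.subst fun j => v (ρ j).succ :=
    fun t ρ => term_subst_subst _ _ _
  have binary : ∀ (f : ∀ {k : ℕ}, LPred.Term (Fin k) → LPred.Term (Fin k) → LPred.Term (Fin k))
      (_ : ∀ {k l : ℕ} (t u : LPred.Term (Fin k)) (σ : Fin k → LPred.Term (Fin l)),
        (f t u).subst σ = f (t.subst σ) (u.subst σ))
      (_ : ∀ {k : ℕ} {Γ : Set (Fml LPred k)} {t t' u u' : LPred.Term (Fin k)},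
        Extends Γ (EqDef LPred) → Deriv Γ (eqF t t') → Deriv Γ (eqF u u') →
        Deriv Γ (eqF (f t u) (f t' u')))
      (_ : ∀ {k : ℕ} {t u : LPred.Term (Fin k)}, IsHATerm t → IsHATerm u → IsHATerm (f t u))
      (t u : LPred.Term (Fin n))
      (_ : ∀ {m : ℕ} (ρ : Fin n → Fin m) (i), PredElim (eqF (v i) (t.subst fun j => v (ρ j))))
      (_ : ∀ {m : ℕ} (ρ : Fin n → Fin m) (i), PredElim (eqF (v i) (u.subst fun j => v (ρ j))))
      {m : ℕ} (ρ : Fin n → Fin m) (i : Fin m),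
      PredElim (eqF (v i) ((f t u).subst fun j => v (ρ j))) := by
    intro f hsub hcongr hHA t u iht ihu m ρ i
    -- Here `v 0` stands for the first argument, and only the second is unnested.
    have h₁ : PredElim (eqF (v i.succ) (f (v 0) (u.subst fun j => v (ρ j).succ))) := by
      have := one_point (P := eqF (v i.succ.succ) (f (v 1) (v 0)))
        (t := u.subst fun j => v (ρ j).succ) (IsHATerm.eqF (.v _) (hHA (.v _) (.v _)))
        (by simpa only [hs] using ihu _ _) (fun Γ h e => by
          simp only [inst_eq, shift_eq, subst_eqF, hsub, subst_v, consSubst_zero]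
          exact h.eq_iff (h.eq_refl _) (hcongr h (h.eq_refl _) e))
      simpa only [inst_eq, subst_eqF, hsub, Term.subst, consSubst_zero, consSubst_one,
        consSubst_succ, v] using this
    have := one_point (t := t.subst fun j => v (ρ j)) h₁
      (by simpa only [hs] using iht _ _) (fun Γ h e => by
        simp only [inst_eq, shift_eq, subst_eqF, hsub, subst_v, consSubst_zero]
        refine h.eq_iff (h.eq_refl _) (hcongr h e ?_)
        simpa [term_subst_subst, v] using h.eq_refl _)
    simpa [inst_eq, hsub, term_subst_subst, v] using this
  have unary : ∀ (f : ∀ {k : ℕ}, LPred.Term (Fin k) → LPred.Term (Fin k))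
      (_ : ∀ {k l : ℕ} (t : LPred.Term (Fin k)) (σ : Fin k → LPred.Term (Fin l)),
        (f t).subst σ = f (t.subst σ))
      (_ : ∀ {k : ℕ} {Γ : Set (Fml LPred k)} {t t' : LPred.Term (Fin k)},
        Extends Γ (EqDef LPred) → Deriv Γ (eqF t t') → Deriv Γ (eqF (f t) (f t')))
      (_ : ∀ {k : ℕ} (i j : Fin k), PredElim (eqF (v i) (f (v j))))
      (t : LPred.Term (Fin n))
      (_ : ∀ {m : ℕ} (ρ : Fin n → Fin m) (i), PredElim (eqF (v i) (t.subst fun j => v (ρ j))))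
      {m : ℕ} (ρ : Fin n → Fin m) (i : Fin m),
      PredElim (eqF (v i) ((f t).subst fun j => v (ρ j))) := by
    intro f hsub hcongr hHA t iht m ρ i
    have := one_point (t := t.subst fun j => v (ρ j)) (hHA i.succ 0)
      (by simpa only [hs] using iht _ _) (fun Γ h e => by
        simp only [inst_eq, shift_eq, subst_eqF, hsub, subst_v, consSubst_zero]
        exact h.eq_iff (h.eq_refl _) (hcongr h e))
    simpa [inst_eq, hsub, term_subst_subst, v] using this
  induction t using LPred_term_ind generalizing m with
  | var j => exact IsHATerm.eqF (.v _) (.v _)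
  | zero => simpa using IsHATerm.eqF (.v i) .zeroT
  | succ t ih =>
    exact unary succT subst_succT Extends.succ_congr
      (fun i j => IsHATerm.eqF (.v _) (.succT (.v _))) t ih ρ i
  | pred t ih =>
    refine unary predT subst_predT Extends.pred_congr (fun i j => ?_) t ih ρ i
    exact congr (fun Γ h => h.eq_pred_iff _ _)
      (((IsHATerm.eqF (.v _) .zeroT).and (IsHATerm.eqF (.v _) .zeroT)).or
        (IsHATerm.eqF (.v _) (.succT (.v _))))
  | add t u iht ihu =>
    exact binary addT subst_addT Extends.add_congr IsHATerm.addT t u iht ihu ρ i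
  | mul t u iht ihu =>
    exact binary mulT subst_mulT Extends.mul_congr IsHATerm.mulT t u iht ihu ρ i

/-- The equation becomes `∃x (x = t ∧ x = u)`, with both conjuncts covered by `var_eq`. -/
protected theorem eqF (t u : LPred.Term (Fin n)) : PredElim (eqF t u) := by
  have := one_point (t := t) (var_eq u Fin.succ 0) (var_eq t Fin.succ 0) (fun Γ h e => by
    simp only [inst_eq, shift_eq, subst_eqF, subst_v, consSubst_zero]
    refine h.eq_iff e ?_
    simpa [term_subst_subst, v] using h.eq_refl _)
  simpa [inst_eq, term_subst_subst, term_subst_var] using this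

/-- Every proposition of HA_Pred is equivalent to a proposition of the language of HA. -/
theorem of_fml (A : Fml LPred n) : PredElim A := by
  induction A with
  | rel R ts =>
    obtain ⟨t, u, h⟩ := LPred_rel_eq R ts
    rw [h]
    exact .eqF t u
  | top => exact .top
  | bot => exact .bot
  | and A B hA hB => exact hA.and hB
  | or A B hA hB => exact hA.or hB
  | imp A B hA hB => exact hA.imp hB
  | all A hA => exact hA.all
  | ex A hA => exact hA.ex

end PredElim

theorem HAPred_extends_HAPredFull : Extends HAPred HAPredFull := by
  rintro A (h | ⟨n, P, rfl⟩)
  · rw [weaken_zero]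
    exact .ax (.inl h)
  · rw [weaken_zero]
    exact .close fun Γ h => (PredElim.of_fml P).indF h

theorem HAPred_subset_HAPredFull : HAPred ⊆ HAPredFull := by
  rintro A (h | ⟨n, P, rfl⟩)
  · exact .inl h
  · exact .inr ⟨n, _, rfl⟩

theorem provable_HAPred_iff {A : Sentence LPred} : Provable HAPred A ↔ Provable HAPredFull A :=
  ⟨fun h => h.mono HAPred_subset_HAPredFull, fun h => HAPred_extends_HAPredFull.provable h⟩

/-! ### The interpretation of HA_N in HA_Pred -/

/-- A term of the language of HA_N, read in the language of HA_Pred. -/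
def interpT {α : Type} : LN.Term α → LPred.Term α
  | .var i => .var i
  | .func f ts => .func (L := LPred) f fun i => interpT (ts i)

/-- The proposition of the language of HA_Pred obtained by reading `Null(t)` as `t = 0` and `N(t)`
as `⊤`. -/
def interp : {n : ℕ} → Fml LN n → Fml LPred n
  | _, .rel NRel.eq ts => eqF (interpT (ts 0)) (interpT (ts 1))
  | _, .rel NRel.null ts => eqF (interpT (ts 0)) zeroT
  | _, .rel NRel.nat _ => .top
  | _, .top => .top
  | _, .bot => .bot
  | _, .and A B => (interp A).and (interp B)
  | _, .or A B => (interp A).or (interp B)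
  | _, .imp A B => (interp A).imp (interp B)
  | _, .all A => .all (interp A)
  | _, .ex A => .ex (interp A)

theorem interpT_subst {α β : Type} (t : LN.Term α) (σ : α → LN.Term β) :
    interpT (t.subst σ) = (interpT t).subst (fun i => interpT (σ i)) := by
  induction t with
  | var i => rfl
  | func f ts ih => simp only [Term.subst, interpT, ih]

theorem interpT_inclN {α : Type} (t : LPred.Term α) : interpT (inclN.onTerm t) = t := by
  induction t with
  | var i => rfl
  | func f ts ih =>
    simp only [LHom.onTerm, interpT, ih]
    rfl

section

variable {n : ℕ} (t u : LN.Term (Fin n))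

@[simp] theorem interpT_v (i : Fin n) : interpT (v i) = v i := rfl

@[simp] theorem interpT_zeroT : interpT (zeroT : LN.Term (Fin n)) = zeroT :=
  congrArg (Term.func _) (funext fun i => i.elim0)

@[simp] theorem interpT_succT : interpT (succT t) = succT (interpT t) :=
  congrArg (Term.func _) (funext fun i => by fin_cases i; rfl)

@[simp] theorem interpT_predT : interpT (predT t) = predT (interpT t) :=
  congrArg (Term.func _) (funext fun i => by fin_cases i; rfl)

@[simp] theorem interpT_addT : interpT (addT t u) = addT (interpT t) (interpT u) :=
  congrArg (Term.func _) (funext fun i => by fin_cases i <;> rfl)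

@[simp] theorem interpT_mulT : interpT (mulT t u) = mulT (interpT t) (interpT u) :=
  congrArg (Term.func _) (funext fun i => by fin_cases i <;> rfl)

@[simp] theorem interp_eqF : interp (eqF t u) = eqF (interpT t) (interpT u) := rfl

@[simp] theorem interp_nullF : interp (nullF t) = eqF (interpT t) zeroT := rfl

@[simp] theorem interp_natF : interp (natF t) = .top := rfl

end

theorem liftSubst_interpT {n m : ℕ} (σ : Fin n → LN.Term (Fin m)) :
    (fun i => interpT (liftSubst σ i)) = liftSubst (fun i => interpT (σ i)) := by
  funext i
  refine Fin.cases rfl (fun i => ?_) i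
  simp [interpT_subst, interpT]

theorem interp_subst {n : ℕ} (A : Fml LN n) {m : ℕ} (σ : Fin n → LN.Term (Fin m)) :
    interp (A.subst σ) = (interp A).subst (fun i => interpT (σ i)) := by
  induction A generalizing m with
  | @rel n k R ts =>
    match k, R, ts with
    | _, NRel.eq, ts => simp only [Fml.subst, interp, interpT_subst, subst_eqF]
    | _, NRel.null, ts => simp only [Fml.subst, interp, interpT_subst, subst_eqF, subst_zeroT]
    | _, NRel.nat, ts => rfl
  | top => rfl
  | bot => rfl
  | and A B hA hB => simp only [Fml.subst, interp, hA, hB]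
  | or A B hA hB => simp only [Fml.subst, interp, hA, hB]
  | imp A B hA hB => simp only [Fml.subst, interp, hA, hB]
  | all A hA => simp only [Fml.subst, interp, hA, liftSubst_interpT]
  | ex A hA => simp only [Fml.subst, interp, hA, liftSubst_interpT]

theorem interp_shift {n : ℕ} (A : Fml LN n) : interp A.shift = (interp A).shift :=
  interp_subst _ _

theorem interp_inst {n : ℕ} (A : Fml LN (n + 1)) (t : LN.Term (Fin n)) :
    interp (A.inst t) = (interp A).inst (interpT t) := by
  rw [inst_eq, interp_subst, inst_eq]
  congr 1
  funext i
  exact Fin.cases rfl (fun i => rfl) i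

theorem interp_atSucc {n : ℕ} (A : Fml LN (n + 1)) :
    interp (atSucc A) = atSucc (interp A) := by
  rw [atSucc_eq, interp_subst, atSucc_eq]
  congr 1
  funext i
  exact Fin.cases (interpT_succT _) (fun i => rfl) i

theorem interp_close {n : ℕ} (A : Fml LN n) : interp A.close = (interp A).close := by
  induction n with
  | zero => rfl
  | succ n ih => exact ih A.all

/-! ### Soundness of the interpretation -/

theorem image_interp_shift {n : ℕ} (Γ : Set (Fml LN n)) :
    interp '' (Fml.shift '' Γ) = Fml.shift '' (interp '' Γ) := by
  simp only [Set.image_image, interp_shift]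

theorem Deriv.interp {n : ℕ} {Γ : Set (Fml LN n)} {A : Fml LN n} (h : Deriv Γ A) :
    Deriv (HeytingArith.interp '' Γ) (HeytingArith.interp A) := by
  induction h with
  | ax h => exact ax ⟨_, h, rfl⟩
  | impI _ ih =>
    rw [Set.image_insert_eq] at ih
    exact impI ih
  | impE _ _ ih₁ ih₂ => exact impE ih₁ ih₂
  | andI _ _ ih₁ ih₂ => exact andI ih₁ ih₂
  | andE₁ _ ih => exact andE₁ ih
  | andE₂ _ ih => exact andE₂ ih
  | orI₁ _ ih => exact orI₁ ih
  | orI₂ _ ih => exact orI₂ ih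
  | orE _ _ _ ih₁ ih₂ ih₃ =>
    rw [Set.image_insert_eq] at ih₂ ih₃
    exact orE ih₁ ih₂ ih₃
  | topI => exact topI
  | botE _ ih => exact botE ih
  | allI _ ih =>
    rw [image_interp_shift] at ih
    exact allI ih
  | allE t _ ih =>
    rw [interp_inst]
    exact allE _ ih
  | exI t _ ih =>
    rw [interp_inst] at ih
    exact exI _ ih
  | exE _ _ ih₁ ih₂ =>
    rw [Set.image_insert_eq, image_interp_shift, interp_shift] at ih₂
    exact exE ih₁ ih₂

theorem Deriv.top_imp_iff {L : FirstOrder.Language.{0, 0}} {n : ℕ} {Γ : Set (Fml L n)}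
    {A : Fml L n} : Deriv Γ ((Fml.top.imp A).iff A) :=
  iff_intro (hyp.impE topI) (impI hyp.weak)

theorem Deriv.top_and_iff {L : FirstOrder.Language.{0, 0}} {n : ℕ} {Γ : Set (Fml L n)}
    {A : Fml L n} : Deriv Γ ((Fml.top.and A).iff A) :=
  iff_intro (andE₂ hyp) (andI topI hyp)

theorem provable_interp_axiom {A : Sentence LN} (hA : HANAxiom A) :
    Provable HAPredFull (interp A) := by
  have hE : ∀ {n : ℕ} {Γ : Set (Fml LPred n)}, Extends Γ HAPredFull → Extends Γ (EqDef LPred) :=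
    fun h => h.anti HAPredFull.eqDef
  cases hA with
  | eqAx hA =>
    refine .ax (.inl (.eqAx ?_))
    -- These axioms contain neither `N` nor `Null`, so each is translated to its own counterpart.
    cases hA <;> simp only [interp, interp_eqF, interpT_v, interpT_succT, interpT_predT,
      interpT_addT, interpT_mulT] <;> constructor
  | eqNull =>
    refine Deriv.close (k := 2) (A := interp ((eqF (v 1) (v 0)).imp
      ((nullF (v 1)).imp (nullF (v 0))))) fun Γ h => ?_
    exact .impI (.impI ((hE h.weak.weak).eq_trans ((hE h.weak.weak).eq_symm Deriv.hyp.weak) .hyp))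
  | eqNat => exact .allI (.allI (.impI (.impI .topI)))
  | defAx hA =>
    refine .ax (.inl (.defAx ?_))
    cases hA <;> simp only [interp, interp_eqF, interpT_v, interpT_succT, interpT_predT,
      interpT_addT, interpT_mulT, interpT_zeroT] <;> constructor
  | natZero => exact .topI
  | natSucc => exact .allI (.impI .topI)
  | nullZero =>
    rw [interp_nullF, interpT_zeroT]
    exact (hE (.self _)).eq_refl _
  | nullSucc =>
    refine Deriv.close (k := 1) (A := interp (nullF (succT (v 0))).neg) fun Γ h => ?_
    have := h.spec (k := 1) (.inl .zeroNeSucc) Term.var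
    rw [subst_var] at this
    simp only [Fml.neg, interp, interp_nullF, interpT_succT, interpT_v] at this ⊢
    -- `Null(S(x))` reads `S(x) = 0`, while the axiom refutes `0 = S(x)`.
    exact .impI (this.weak.impE ((hE h.weak).eq_symm .hyp))
  | @ind n P =>
    rw [interp_close]
    refine .close fun Γ h => ?_
    have := h.spec (.inr ⟨n, interp P, rfl⟩) Term.var
    rw [subst_var] at this
    simp only [indNF, interp, interp_inst, interp_atSucc, interp_natF, interpT_zeroT]
    -- With `N` read as `⊤`, the HA_N instance is `indF (interp P)` with two superfluous premises
    -- `⊤`.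
    exact Deriv.iff_mpr (.iff_imp .iff_refl
      (.iff_imp (.iff_all .top_imp_iff) (.iff_all .top_imp_iff))) this

/-! ### Composition of the two translations -/

theorem provable_interp {A : Sentence LN} (hA : Provable HAN A) :
    Provable HAPredFull (interp A) := by
  refine hA.interp.cut ?_
  rintro _ ⟨B, hB, rfl⟩
  exact provable_interp_axiom hB

/-- Pure logic, hence valid over any `Γ`: the relativized quantifiers become `∀x (⊤ ⇒ A)` and `∃x (⊤
∧ A)`. -/
theorem interp_relativize {n : ℕ} (A : Fml LPred n) {Γ : Set (Fml LPred n)} :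
    Deriv Γ ((interp (relativize A)).iff A) := by
  induction A with
  | rel R ts =>
    obtain ⟨t, u, h⟩ := LPred_rel_eq R ts
    rw [h, relativize_eqF, interp_eqF, interpT_inclN, interpT_inclN]
    exact .iff_refl
  | top => exact .iff_refl
  | bot => exact .iff_refl
  | and A B hA hB => exact .iff_and hA hB
  | or A B hA hB => exact .iff_or hA hB
  | imp A B hA hB => exact .iff_imp hA hB
  | all A hA => exact .iff_all (.iff_trans .top_imp_iff hA)
  | ex A hA => exact .iff_ex (.iff_trans .top_and_iff hA)

theorem provable_relativize_iff {A : Sentence LPred} :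
    Provable HAPredFull A ↔ Provable HAN (relativize A) :=
  ⟨provable_relativize, fun h => (interp_relativize A).iff_mp (provable_interp h)⟩

end HeytingArith


theorem mainTheorem7 (A : HeytingArith.Sentence HeytingArith.LPred) :
    (HeytingArith.Provable HeytingArith.HAPred A ↔
      HeytingArith.Provable HeytingArith.HAN (HeytingArith.relativize A)) ∧
    (HeytingArith.Provable HeytingArith.HAPredFull A ↔
      HeytingArith.Provable HeytingArith.HAN (HeytingArith.relativize A)) :=
  ⟨HeytingArith.provable_HAPred_iff.trans HeytingArith.provable_relativize_iff,
    HeytingArith.provable_relativize_iff⟩
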